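/- Let $n\ge 2$, let $p,q\in(1,\infty)$ with $\frac1p+\frac1q=1$, and equip $\mathbb R^{n+1}$ with the Euclidean inner product and norm, writing $x=(x_0,\bar x)\in\mathbb R\times\mathbb R^n$ and $\operatorname{dist}(x,C)=\inf_{y\in C}\|x-y\|$. For $r\in\{p,q\}$ let $K_r=\{x\in\mathbb R^{n+1} : x_0\ge(\sum_{i=1}^n|x_i|^r)^{1/r}\}$, and let $\partial K_r$ be its boundary. Closed convex sets $C_1,C_2\subseteq\mathbb R^{n+1}$ with $C_1\cap C_2\ne\emptyset$ satisfy a *uniform Hölderian error bound with exponent* $\gamma\in(0,1]$ if for every bounded $B\subseteq\mathbb R^{n+1}$ there is $\kappa_B>0$ with $$\operatorname{dist}(x,C_1\cap C_2)\le\kappa_B\max\{\operatorname{dist}(x,C_1),\operatorname{dist}(x,C_2)\}^{\gamma}\quad\text{for all }x\in B;$$ if $\gamma=1$ the error bound is called *Lipschitzian*. A function $\Phi:[0,\infty)^2\to[0,\infty)$ is a *consistent error bound function* for $C_1,C_2$ if $\operatorname{dist}(x,C_1\cap C_2)\le\Phi(\max\{\operatorname{dist}(x,C_1),\operatorname{dist}(x,C_2)\},\|x\|)$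 for all $x\in\mathbb R^{n+1}$; for each $b\ge0$ the function $\Phi(\cdot,b)$ is nondecreasing, right-continuous at $0$ and satisfies $\Phi(0,b)=0$; and for each $a\ge0$ the function $\Phi(a,\cdot)$ is nondecreasing. For $z\in\mathbb R^{n+1}$ let $J_z=\{i\in\{1,\dots,n\}: z_i\ne0\}$ and $$\alpha_z=\begin{cases}\frac12 & \text{if }|J_z|=n,\\ \frac1p & \text{if }|J_z|=1\text{ and }p<2,\\ \min\{\frac12,\frac1p\} & \text{otherwise.}\end{cases}$$ **Theorem.** Let $L\subseteq\mathbb R^{n+1}$ be a linear subspace and $a\in\mathbb R^{n+1}$ with $(L+a)\cap K_p\ne\emptyset$. (i) If $(L+a)\cap K_p=\{0\}$ or $L+a$ meets the relative interior of $K_p$, then $K_p$ and $L+a$ satisfy a Lipschitzian error bound. (ii) Otherwise, there is a nonzero $z\in\partial K_q\cap L^\perp\cap\{a\}^\perp$, and for every such $z$ we have $\alpha_z\ge\min\{\frac12,\frac1p\}$, and $K_p$ and $L+a$ satisfy a uniform Hölderian error bound with exponent $\alpha_z$. Furthermore, the exponent in (ii) is optimal: let $0\ne z\in\partial K_q$ and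 take $L=\{z\}^\perp$, $a=0$. Then for every consistent error bound function $\Phi$ for $K_p$ and $\{z\}^\perp$ and every $\hat\eta>0$ there are $\hat\kappa>0$ and $s_0>0$ such that $$s^{\alpha_z}\le\hat\kappa\,\Phi(\hat\kappa s,\hat\eta)\quad\text{for all }s\in[0,s_0].$$ In particular, $K_p$ and $\{z\}^\perp$ do not satisfy a uniform Hölderian error bound with any exponent $\hat\alpha$ with $\alpha_z<\hat\alpha\le1$. -/

import Mathlib

open scoped NNReal

noncomputable section

/-- The `p`-norm of `x̄`, where `x = (x₀, x̄) ∈ ℝ^{n+1}` and `x̄ = (x₁, …, xₙ)`. -/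
def tailPNorm {n : ℕ} (p : ℝ) (x : EuclideanSpace ℝ (Fin (n + 1))) : ℝ :=
  (∑ i : Fin n, |x i.succ| ^ p) ^ (1 / p)

/-- The `p`-cone `{x = (x₀, x̄) ∈ ℝ^{n+1} | x₀ ≥ ‖x̄‖_p}`. -/
def pCone (n : ℕ) (p : ℝ) : Set (EuclideanSpace ℝ (Fin (n + 1))) :=
  {x | tailPNorm p x ≤ x 0}

/-- `J_z`: the positions of the nonzero entries of `z̄`, where `z = (z₀, z̄)`. -/
def tailSupport {n : ℕ} (z : EuclideanSpace ℝ (Fin (n + 1))) : Finset (Fin n) :=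
  Finset.univ.filter fun i => z i.succ ≠ 0

/-- The exponent `α_z` of the `p`-cone in `ℝ^{n+1}`. -/
def pExponent {n : ℕ} (p : ℝ) (z : EuclideanSpace ℝ (Fin (n + 1))) : ℝ :=
  if (tailSupport z).card = n then 1 / 2
  else if (tailSupport z).card = 1 ∧ p < 2 then 1 / p
  else min (1 / 2) (1 / p)

/-- `C₁, C₂` satisfy a uniform Hölderian error bound with exponent `γ ∈ (0, 1]`
(used for closed convex sets with `C₁ ∩ C₂` nonempty). -/
def HolderErrorBound {E : Type*} [NormedAddCommGroup E] (C₁ C₂ : Set E) (γ : ℝ) : Prop :=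
  0 < γ ∧ γ ≤ 1 ∧
    ∀ B : Set E, Bornology.IsBounded B → ∃ κ : ℝ, 0 < κ ∧ ∀ x ∈ B,
      Metric.infDist x (C₁ ∩ C₂) ≤ κ * max (Metric.infDist x C₁) (Metric.infDist x C₂) ^ γ

/-- A Lipschitzian error bound is a uniform Hölderian error bound with exponent `1`. -/
def LipschitzErrorBound {E : Type*} [NormedAddCommGroup E] (C₁ C₂ : Set E) : Prop :=
  HolderErrorBound C₁ C₂ 1

/-- `Φ : ℝ₊ × ℝ₊ → ℝ₊` is a consistent error bound function for `C₁, C₂`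
(used for closed convex sets with `C₁ ∩ C₂` nonempty). -/
structure IsConsistentErrorBound {E : Type*} [NormedAddCommGroup E] (C₁ C₂ : Set E)
    (Φ : ℝ≥0 → ℝ≥0 → ℝ≥0) : Prop where
  bound : ∀ x : E, Metric.infNndist x (C₁ ∩ C₂) ≤
    Φ (max (Metric.infNndist x C₁) (Metric.infNndist x C₂)) ‖x‖₊
  mono_left : ∀ b : ℝ≥0, Monotone fun a => Φ a b
  /-- On `ℝ≥0`, continuity at `0` is right-continuity at `0`. -/
  cont_zero : ∀ b : ℝ≥0, ContinuousAt (fun a => Φ a b) 0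
  zero_left : ∀ b : ℝ≥0, Φ 0 b = 0
  mono_right : ∀ a : ℝ≥0, Monotone fun b => Φ a b

end

/-! Everything is measured by the defect in Young's inequality. Put `ζ i = z i.succ / z 0`, so that
`∑ |ζ i| ^ q = 1`. For `v` on the unit sphere of the `p`-norm, `1 - ∑ ζ i * v i` is the sum of the
coordinatewise defects `youngGap`. Each is nonnegative and vanishes at `youngDual q (ζ i)`; it grows
quadratically there if `ζ i ≠ 0`, and equals `|v i| ^ p / p` if `ζ i = 0`. This produces the
exponents `1/2` and `1/p`. If `ζ` has a single nonzero entry, that coordinate is controlled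
linearly, so only `1/p` remains.

By homogeneity, a point `y` of the cone in a bounded set lies within a multiple of `⟪z, y⟫ ^ α` of
the exposed ray (`exists_norm_sub_exposedRay_le`). If `z` is orthogonal to `L` and `a`, a point at
distance at most `ε` from both sets has a projection `y` onto the cone with `⟪z, y⟫ = O(ε)`. So it
is `O(ε ^ α)` from the ray, and a linear bound between the ray and `L + a`
(`exists_infDist_ray_inter_le`) gives `holderErrorBound_pExponent`. Such a `z` comes from separating
the interior of the cone from `L + a` (`exists_frontier_supporting`). The Lipschitzian cases use a
Slater point or compactness.

For optimality, perturb the exposed ray in a direction `w` with `∑ ζ i * w i = 0`. A step `t` costs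
`O(t ^ γ)` in distance to `{z}ᗮ`, but moves at distance at least a multiple of `t` from the ray
(`exists_family_of_youngGap_le`). Here `γ = p` along a zero coordinate and `γ = 2` in the plane of
two nonzero ones; one of the two matches `α_z` (`pExponent_attained`). -/

/-! ### Young's inequality in one variable: growth of the defect. -/

/-- The defect in Young's inequality `ζ * v ≤ |v| ^ p / p + |ζ| ^ q / q`. -/
noncomputable def youngGap (p q ζ v : ℝ) : ℝ := |v| ^ p / p + |ζ| ^ q / q - ζ * v

/-- The point at which the defect in Young's inequality vanishes. -/
noncomputable def youngDual (q ζ : ℝ) : ℝ := SignType.sign ζ * |ζ| ^ (q - 1)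

lemma youngGap_nonneg {p q : ℝ} (h : p.HolderConjugate q) (ζ v : ℝ) : 0 ≤ youngGap p q ζ v := by
  have := Real.young_inequality v ζ h
  unfold youngGap
  linarith [mul_comm v ζ]

lemma youngGap_neg (p q ζ v : ℝ) : youngGap p q (-ζ) (-v) = youngGap p q ζ v := by
  simp [youngGap]

lemma youngDual_neg (q ζ : ℝ) : youngDual q (-ζ) = -youngDual q ζ := by
  simp [youngDual, Left.sign_neg]

@[simp] lemma youngDual_zero (q : ℝ) : youngDual q 0 = 0 := by simp [youngDual]

lemma youngDual_of_pos {ζ : ℝ} (q : ℝ) (hζ : 0 < ζ) : youngDual q ζ = ζ ^ (q - 1) := by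
  simp [youngDual, hζ, abs_of_pos]

lemma mul_youngDual {q : ℝ} (hq : 1 < q) (ζ : ℝ) : ζ * youngDual q ζ = |ζ| ^ q := by
  rcases eq_or_ne ζ 0 with rfl | h
  · simp [Real.zero_rpow (by linarith : q ≠ 0)]
  · have h1 : |ζ| ^ q = |ζ| * |ζ| ^ (q - 1) := by
      rw [← Real.rpow_one_add' (abs_nonneg _) (by linarith)]; ring_nf
    rw [youngDual, h1, ← mul_assoc, mul_comm ζ, sign_mul_self]

lemma abs_youngDual {q : ℝ} (hq : 1 < q) (ζ : ℝ) : |youngDual q ζ| = |ζ| ^ (q - 1) := by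
  rcases eq_or_ne ζ 0 with rfl | h
  · simp [Real.zero_rpow (by linarith : q - 1 ≠ 0)]
  · rw [youngDual, abs_mul, abs_of_nonneg (Real.rpow_nonneg (abs_nonneg ζ) _)]
    rcases lt_or_gt_of_ne h with h | h <;> simp [h]

lemma abs_youngDual_rpow {p q : ℝ} (h : p.HolderConjugate q) (ζ : ℝ) :
    |youngDual q ζ| ^ p = |ζ| ^ q := by
  rw [abs_youngDual h.symm.lt, ← Real.rpow_mul (abs_nonneg ζ), h.symm.sub_one_mul_conj]

lemma youngGap_youngDual {p q : ℝ} (h : p.HolderConjugate q) (ζ : ℝ) :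
    youngGap p q ζ (youngDual q ζ) = 0 := by
  rw [youngGap, abs_youngDual_rpow h, mul_youngDual h.symm.lt]
  have := h.inv_add_inv_eq_one
  rw [div_eq_mul_inv, div_eq_mul_inv, ← mul_add, this]; ring

-- L'Hôpital: the derivative `v ^ (p - 1) - ζ` vanishes at the dual point because `(p - 1) * (q - 1)
-- = 1`. The limit is half the second derivative, positive for every `p > 1` since the dual point is
-- not `0`.
open Filter Topology in
lemma tendsto_youngGap_div_sq {p q : ℝ} (h : p.HolderConjugate q) {ζ : ℝ} (hζ : 0 < ζ) :
    Tendsto (fun v => youngGap p q ζ v / (v - youngDual q ζ) ^ 2) (𝓝[≠] (youngDual q ζ))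
      (𝓝 ((p - 1) * youngDual q ζ ^ (p - 2) / 2)) := by
  set d := youngDual q ζ with hd
  have hd0 : 0 < d := by rw [hd, youngDual_of_pos q hζ]; positivity
  have hp := h.pos
  have hdζ : d ^ (p - 1) = ζ := by
    rw [hd, youngDual_of_pos q hζ, ← Real.rpow_mul hζ.le, show (q - 1) * (p - 1) = 1 by
      linarith [h.mul_eq_add], Real.rpow_one]
  have hpos : ∀ᶠ v in 𝓝[≠] d, 0 < v :=
    nhdsWithin_le_nhds (lt_mem_nhds hd0)
  have hne : ∀ᶠ v in 𝓝[≠] d, v ≠ d := eventually_mem_nhdsWithin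
  have hder : ∀ v : ℝ, 0 < v → HasDerivAt (youngGap p q ζ) (v ^ (p - 1) - ζ) v := by
    intro v hv
    have h1 : HasDerivAt (fun v : ℝ => v ^ p / p + |ζ| ^ q / q - ζ * v) (v ^ (p - 1) - ζ) v := by
      have := (((Real.hasDerivAt_rpow_const (x := v) (p := p) (Or.inl hv.ne')).div_const p).add_const
        (|ζ| ^ q / q)).sub ((hasDerivAt_id v).const_mul ζ)
      convert! this using 1
      field_simp
    refine h1.congr_of_eventuallyEq ?_
    filter_upwards [lt_mem_nhds hv] with w hw
    simp [youngGap, abs_of_pos hw]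
  refine HasDerivAt.lhopital_zero_nhdsNE (f' := fun v => v ^ (p - 1) - ζ)
    (g' := fun v => 2 * (v - d)) ?_ ?_ ?_ ?_ ?_ ?_
  · filter_upwards [hpos] with v hv using hder v hv
  · filter_upwards with v
    have := ((hasDerivAt_id v).sub_const d).pow 2
    convert! this using 1
    simp
  · filter_upwards [hne] with v hv
    simpa [sub_eq_zero] using hv
  · have := (hder d hd0).continuousAt.tendsto
    rw [hd, youngGap_youngDual h] at this
    exact this.mono_left nhdsWithin_le_nhds
  · have : Tendsto (fun v : ℝ => (v - d) ^ 2) (𝓝 d) (𝓝 ((d - d) ^ 2)) :=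
      Continuous.tendsto (by fun_prop) d
    simp only [sub_self, ne_eq, OfNat.ofNat_ne_zero, not_false_eq_true, zero_pow] at this
    exact this.mono_left nhdsWithin_le_nhds
  · have h2 := (hasDerivAt_iff_tendsto_slope.1
      (Real.hasDerivAt_rpow_const (x := d) (p := p - 1) (Or.inl hd0.ne'))).div_const 2
    rw [show p - 1 - 1 = p - 2 by ring] at h2
    refine h2.congr fun v => ?_
    rw [slope_def_field, hdζ, div_div, mul_comm]

-- The lower bound feeds the error bound, the upper bound its optimality.
open Filter Topology in
lemma eventually_youngGap_bounds {p q : ℝ} (h : p.HolderConjugate q) {ζ : ℝ} (hζ : ζ ≠ 0) :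
    ∃ c C : ℝ, 0 < c ∧ 0 < C ∧ ∀ᶠ v in 𝓝 (youngDual q ζ),
      c * (v - youngDual q ζ) ^ 2 ≤ youngGap p q ζ v ∧
      youngGap p q ζ v ≤ C * (v - youngDual q ζ) ^ 2 := by
  wlog hpos : 0 < ζ generalizing ζ
  · obtain ⟨c, C, hc, hC, hev⟩ := this (neg_ne_zero.2 hζ)
      (neg_pos.2 (lt_of_le_of_ne (not_lt.1 hpos) hζ))
    refine ⟨c, C, hc, hC, ?_⟩
    rw [youngDual_neg] at hev
    have ht : Tendsto (fun v : ℝ => -v) (𝓝 (youngDual q ζ)) (𝓝 (-youngDual q ζ)) :=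
      continuous_neg.tendsto _
    filter_upwards [ht.eventually hev] with v hv
    rw [youngGap_neg, show (-v - -youngDual q ζ) ^ 2 = (v - youngDual q ζ) ^ 2 by ring] at hv
    exact hv
  · have ht := tendsto_youngGap_div_sq h hpos
    have hd0 : 0 < youngDual q ζ := by rw [youngDual_of_pos q hpos]; positivity
    set m := (p - 1) * youngDual q ζ ^ (p - 2) / 2
    have hm : 0 < m := by
      have := h.sub_one_pos
      positivity
    refine ⟨m / 2, 2 * m, by positivity, by positivity, ?_⟩
    have hev := (ht.eventually (lt_mem_nhds (half_lt_self hm))).and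
      (ht.eventually (gt_mem_nhds (by linarith : m < 2 * m)))
    rw [eventually_nhdsWithin_iff] at hev
    filter_upwards [hev] with v hv
    rcases eq_or_ne v (youngDual q ζ) with rfl | hne
    · simp [youngGap_youngDual h]
    · obtain ⟨h1, h2⟩ := hv hne
      have hsq : 0 < (v - youngDual q ζ) ^ 2 := by
        have := sub_ne_zero.2 hne
        positivity
      exact ⟨((lt_div_iff₀ hsq).1 h1).le, ((div_lt_iff₀ hsq).1 h2).le⟩

lemma convexOn_youngGap {p q : ℝ} (h : p.HolderConjugate q) (ζ : ℝ) :
    ConvexOn ℝ Set.univ (youngGap p q ζ) := by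
  have h1 : ConvexOn ℝ Set.univ (fun v : ℝ => |v| ^ p) := by
    refine ⟨convex_univ, fun x _ y _ a b ha hb hab => ?_⟩
    have h2 := (convexOn_rpow h.lt.le).2 (Set.mem_Ici.2 (abs_nonneg x))
      (Set.mem_Ici.2 (abs_nonneg y)) ha hb hab
    refine le_trans (Real.rpow_le_rpow (abs_nonneg _) ?_ h.pos.le) h2
    simp only [smul_eq_mul]
    refine (abs_add_le _ _).trans_eq ?_
    rw [abs_mul, abs_mul, abs_of_nonneg ha, abs_of_nonneg hb]
  refine ⟨convex_univ, fun x _ y _ a b ha hb hab => ?_⟩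
  have h2 := h1.2 (Set.mem_univ x) (Set.mem_univ y) ha hb hab
  simp only [smul_eq_mul, youngGap] at h2 ⊢
  have h3 : |a * x + b * y| ^ p / p ≤ (a * |x| ^ p + b * |y| ^ p) / p :=
    div_le_div_of_nonneg_right h2 h.pos.le
  have hb' : b = 1 - a := by linarith
  subst hb'
  calc _ ≤ (a * |x| ^ p + (1 - a) * |y| ^ p) / p + |ζ| ^ q / q - ζ * (a * x + (1 - a) * y) := by
        gcongr
    _ = _ := by ring

/-- Convexity carries the local quadratic bound to the whole interval: beyond distance `r` from its
zero the defect grows at least linearly, which dominates a square on a bounded range. -/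
lemma exists_mul_sq_le_youngGap {p q : ℝ} (h : p.HolderConjugate q) {ζ : ℝ} (hζ : ζ ≠ 0) :
    ∃ c : ℝ, 0 < c ∧ ∀ v, |v| ≤ 1 → c * (v - youngDual q ζ) ^ 2 ≤ youngGap p q ζ v := by
  obtain ⟨c, _, hc, _, hev⟩ := eventually_youngGap_bounds h hζ
  obtain ⟨ρ, hρ, hball⟩ := Metric.eventually_nhds_iff.1 hev
  set d := youngDual q ζ
  set r := ρ / 2
  have hr : 0 < r := by positivity
  -- `1 + |d|` bounds `|v - d|` for `|v| ≤ 1`; the summand `r` makes `r / M ≤ 1`, so the final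
  -- constant is at most the local one.
  set M := 1 + |d| + r
  have hM : 0 < M := by positivity
  have hrM : r ≤ M := by have := abs_nonneg d; simp only [M]; linarith
  refine ⟨c * r / M, by positivity, fun v hv => ?_⟩
  have hvM : |v - d| ≤ M := (abs_sub _ _).trans (by simp only [M]; linarith)
  rcases lt_or_ge |v - d| ρ with hlt | hge
  · refine le_trans ?_ (hball (by rwa [Real.dist_eq])).1
    gcongr
    rw [div_le_iff₀ hM]; gcongr
  · have hpos : 0 < |v - d| := hρ.trans_le hge
    set θ := r / |v - d|
    have hθ : 0 < θ := by positivity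
    have hθ1 : θ ≤ 1 := by rw [div_le_one hpos]; exact (half_le_self hρ.le).trans hge
    have hθv : θ * |v - d| = r := div_mul_cancel₀ _ hpos.ne'
    have hconv := (convexOn_youngGap h ζ).2 (Set.mem_univ d) (Set.mem_univ v)
      (sub_nonneg.2 hθ1) hθ.le (by ring)
    have hdist : |(1 - θ) * d + θ * v - d| = r := by
      rw [show (1 - θ) * d + θ * v - d = θ * (v - d) by ring, abs_mul, abs_of_pos hθ, hθv]
    have h1 := (hball (y := (1 - θ) * d + θ * v)
      (by rw [Real.dist_eq, hdist]; exact half_lt_self hρ)).1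
    rw [← sq_abs, hdist] at h1
    simp only [smul_eq_mul] at hconv
    rw [youngGap_youngDual h, mul_zero, zero_add] at hconv
    have h2 : c * r * |v - d| ≤ youngGap p q ζ v := by
      have : θ * (c * r * |v - d|) ≤ θ * youngGap p q ζ v := by
        calc θ * (c * r * |v - d|) = c * r * (θ * |v - d|) := by ring
          _ = c * r ^ 2 := by rw [hθv]; ring
          _ ≤ _ := h1.trans hconv
      exact le_of_mul_le_mul_left this hθ
    refine le_trans ?_ h2
    rw [← sq_abs, div_mul_eq_mul_div, div_le_iff₀ hM, pow_two, ← mul_assoc]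
    gcongr

/-- The total defect ranges over `[0, 2]`, so lowering the exponent costs a factor of at most `2`.
-/
lemma rpow_le_two_mul_rpow {δ α β : ℝ} (h0 : 0 ≤ δ) (h2 : δ ≤ 2) (hα : 0 < α) (hαβ : α ≤ β)
    (hβ : β ≤ 1) : δ ^ β ≤ 2 * δ ^ α := by
  have h1 : δ ^ β = δ ^ (β - α) * δ ^ α := by
    rw [← Real.rpow_add_of_nonneg h0 (by linarith) hα.le]; ring_nf
  rw [h1]
  have h3 : δ ^ (β - α) ≤ 2 := by
    calc δ ^ (β - α) ≤ 2 ^ (β - α) := Real.rpow_le_rpow h0 h2 (by linarith)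
      _ ≤ 2 ^ (1 : ℝ) := Real.rpow_le_rpow_of_exponent_le (by norm_num) (by linarith)
      _ = 2 := Real.rpow_one 2
  gcongr

/-! ### Stability of Hölder's inequality near equality. -/

section Vector

variable {ι : Type*} [Fintype ι] {p q : ℝ} {ζ : ι → ℝ}

lemma sum_youngGap (hζ : ∑ i, |ζ i| ^ q = 1) (v : ι → ℝ) :
    ∑ i, youngGap p q (ζ i) (v i) = (∑ i, |v i| ^ p) / p + 1 / q - ∑ i, ζ i * v i := by
  simp only [youngGap, Finset.sum_sub_distrib, Finset.sum_add_distrib, ← Finset.sum_div, hζ]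

lemma abs_le_one_of_sum_rpow (hp : 0 < p) {v : ι → ℝ} (hv : ∑ i, |v i| ^ p = 1) (i : ι) :
    |v i| ≤ 1 := by
  have h1 : |v i| ^ p ≤ 1 := hv ▸ Finset.single_le_sum (f := fun i => |v i| ^ p)
    (fun i _ => Real.rpow_nonneg (abs_nonneg _) _) (Finset.mem_univ i)
  by_contra hlt
  exact absurd (Real.one_lt_rpow (not_le.1 hlt) hp) (not_lt.2 h1)

lemma abs_sum_mul_le_one (h : p.HolderConjugate q) (hζ : ∑ i, |ζ i| ^ q = 1) {v : ι → ℝ}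
    (hv : ∑ i, |v i| ^ p = 1) : |∑ i, ζ i * v i| ≤ 1 := by
  have h1 := Real.inner_le_Lp_mul_Lq Finset.univ v ζ h
  have h2 := Real.inner_le_Lp_mul_Lq Finset.univ (fun i => - v i) ζ h
  simp only [abs_neg, hζ, hv, Real.one_rpow, mul_one, neg_mul, Finset.sum_neg_distrib] at h1 h2
  simp only [mul_comm] at h1 h2 ⊢
  exact abs_le.2 ⟨by linarith, h1⟩

lemma exists_abs_sub_youngDual_le (h : p.HolderConjugate q) (hζ : ∑ i, |ζ i| ^ q = 1) {α : ℝ}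
    (hα : 0 < α) (hα1 : α ≤ 1) (hzero : ∀ i, ζ i = 0 → α ≤ 1 / p)
    (hhalf : α ≤ 1 / 2 ∨ ∃ j, ∀ i, i ≠ j → ζ i = 0) (i : ι) :
    ∃ C : ℝ, 0 < C ∧ ∀ v : ι → ℝ, ∑ i, |v i| ^ p = 1 →
      |v i - youngDual q (ζ i)| ≤ C * (1 - ∑ i, ζ i * v i) ^ α := by
  have hp := h.pos
  -- A single defect is at most the sum of all, which on the unit sphere is the Hölder defect.
  have hgap : ∀ v : ι → ℝ, ∑ i, |v i| ^ p = 1 → youngGap p q (ζ i) (v i) ≤ 1 - ∑ i, ζ i * v i := by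
    intro v hv
    have h1 := sum_youngGap (p := p) hζ v
    rw [hv] at h1
    have h2 : 1 / p + 1 / q = 1 := by simpa using h.inv_add_inv_eq_one
    rw [h2] at h1
    rw [← h1]
    exact Finset.single_le_sum (f := fun i => youngGap p q (ζ i) (v i))
      (fun i _ => youngGap_nonneg h _ _) (Finset.mem_univ i)
  have hδ : ∀ v : ι → ℝ, ∑ i, |v i| ^ p = 1 →
      0 ≤ 1 - ∑ i, ζ i * v i ∧ 1 - ∑ i, ζ i * v i ≤ 2 := by
    intro v hv
    have := abs_le.1 (abs_sum_mul_le_one h hζ hv)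
    exact ⟨by linarith, by linarith⟩
  by_cases hi : ζ i = 0
  · refine ⟨p ^ (1 / p) * 2, by positivity, fun v hv => ?_⟩
    obtain ⟨h0, h2⟩ := hδ v hv
    have hg := hgap v hv
    set δ := 1 - ∑ i, ζ i * v i
    rw [hi, youngDual_zero, sub_zero]
    rw [hi, youngGap, abs_zero, Real.zero_rpow h.symm.ne_zero, zero_div, zero_mul, add_zero,
      sub_zero, div_le_iff₀ hp] at hg
    have h3 : |v i| ≤ (p * δ) ^ (1 / p) := by
      have := Real.rpow_le_rpow (by positivity) hg (by positivity : 0 ≤ 1 / p)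
      rwa [← Real.rpow_mul (abs_nonneg _), mul_one_div_cancel hp.ne', Real.rpow_one,
        mul_comm] at this
    rw [Real.mul_rpow hp.le h0] at h3
    refine h3.trans ?_
    rw [mul_assoc]
    gcongr
    exact rpow_le_two_mul_rpow h0 h2 hα (hzero i hi) ((div_le_one hp).2 h.lt.le)
  · rcases hhalf with hhalf | ⟨j, hj⟩
    · obtain ⟨c, hc, hcv⟩ := exists_mul_sq_le_youngGap h hi
      refine ⟨(1 / c) ^ (1 / 2 : ℝ) * 2, by positivity, fun v hv => ?_⟩
      obtain ⟨h0, h2⟩ := hδ v hv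
      have hg := (hcv (v i) (abs_le_one_of_sum_rpow hp hv i)).trans (hgap v hv)
      set δ := 1 - ∑ i, ζ i * v i
      have h3 : (v i - youngDual q (ζ i)) ^ 2 ≤ 1 / c * δ := by
        rw [one_div_mul_eq_div, le_div_iff₀ hc, mul_comm]; exact hg
      have h4 : |v i - youngDual q (ζ i)| ≤ (1 / c * δ) ^ (1 / 2 : ℝ) := by
        rw [← Real.sqrt_eq_rpow]
        exact Real.abs_le_sqrt h3
      rw [Real.mul_rpow (by positivity) h0] at h4
      refine h4.trans ?_
      rw [mul_assoc]
      gcongr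
      exact rpow_le_two_mul_rpow h0 h2 hα hhalf (by norm_num)
    -- With one nonzero entry, `|ζ i| = 1`, and the distance to the dual point equals the Hölder
    -- defect itself; no square root is lost.
    · have hij : i = j := by by_contra hne; exact hi (hj i hne)
      subst hij
      refine ⟨2, by norm_num, fun v hv => ?_⟩
      obtain ⟨h0, h2⟩ := hδ v hv
      have hsum : ∑ k, ζ k * v k = ζ i * v i :=
        Finset.sum_eq_single i (fun k _ hk => by rw [hj k hk, zero_mul]) (by simp)
      have hone : |ζ i| ^ q = 1 := by
        rw [← hζ]
        symm
        refine Finset.sum_eq_single i (fun k _ hk => ?_) (by simp)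
        rw [hj k hk, abs_zero, Real.zero_rpow h.symm.ne_zero]
      have habs : |ζ i| = 1 := by
        have := congrArg (· ^ (1 / q)) hone
        simpa [← Real.rpow_mul (abs_nonneg (ζ i)), mul_inv_cancel₀ h.symm.ne_zero] using this
      have hdual : |v i - youngDual q (ζ i)| = 1 - ∑ k, ζ k * v k := by
        rw [← abs_of_nonneg h0, hsum]
        calc |v i - youngDual q (ζ i)| = |ζ i| * |v i - youngDual q (ζ i)| := by
              rw [habs, one_mul]
          _ = |ζ i * v i - 1| := by rw [← abs_mul, mul_sub, mul_youngDual h.symm.lt, hone]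
          _ = _ := abs_sub_comm _ _
      rw [hdual]
      have := rpow_le_two_mul_rpow h0 h2 hα hα1 le_rfl
      rwa [Real.rpow_one] at this

/-- The homogeneous form: rescale to the unit sphere, where `N ^ (1 - α) * (N * δ) ^ α = N * δ ^ α`.
-/
lemma exists_sum_abs_sub_youngDual_le (h : p.HolderConjugate q) (hζ : ∑ i, |ζ i| ^ q = 1) {α : ℝ}
    (hα : 0 < α) (hα1 : α ≤ 1) (hzero : ∀ i, ζ i = 0 → α ≤ 1 / p)
    (hhalf : α ≤ 1 / 2 ∨ ∃ j, ∀ i, i ≠ j → ζ i = 0) :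
    ∃ C : ℝ, 0 < C ∧ ∀ (v : ι → ℝ) (N : ℝ), N = (∑ i, |v i| ^ p) ^ (1 / p) →
      ∑ i, |v i - N * youngDual q (ζ i)| ≤ C * (N ^ (1 - α) * (N - ∑ i, ζ i * v i) ^ α) := by
  choose C hC hCv using exists_abs_sub_youngDual_le h hζ hα hα1 hzero hhalf
  have hp := h.pos
  have hCs : 0 ≤ ∑ i, C i := Finset.sum_nonneg fun i _ => (hC i).le
  -- The `+ 1` keeps the constant positive when `ι` is empty.
  refine ⟨∑ i, C i + 1, by positivity, fun v N hN => ?_⟩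
  have hS : 0 ≤ ∑ i, |v i| ^ p := Finset.sum_nonneg fun i _ => by positivity
  have hN0 : 0 ≤ N := hN ▸ by positivity
  rcases hN0.eq_or_lt with h0 | hpos
  · have hv : ∀ i, v i = 0 := by
      rw [← h0] at hN
      have hs := (Real.rpow_eq_zero hS (by positivity)).1 hN.symm
      intro i
      have := (Finset.sum_eq_zero_iff_of_nonneg (fun i _ => by positivity)).1 hs i
        (Finset.mem_univ i)
      simpa using (Real.rpow_eq_zero (abs_nonneg _) hp.ne').1 this
    simp [hv, ← h0, Real.zero_rpow hα.ne']
  · have hNp : N ^ p = ∑ i, |v i| ^ p := by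
      rw [hN, ← Real.rpow_mul hS, one_div_mul_cancel hp.ne', Real.rpow_one]
    have hw : ∑ i, |v i / N| ^ p = 1 := by
      simp only [abs_div, abs_of_pos hpos, Real.div_rpow (abs_nonneg _) hpos.le,
        ← Finset.sum_div]
      rw [← hNp, div_self (by positivity)]
    set δ := 1 - ∑ i, ζ i * (v i / N) with hδ
    have hδ0 : 0 ≤ δ := by
      have := abs_le.1 (abs_sum_mul_le_one h hζ hw)
      linarith
    have hNδ : N - ∑ i, ζ i * v i = N * δ := by
      simp only [hδ, ← mul_div_assoc, ← Finset.sum_div]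
      field_simp
    rw [hNδ, Real.mul_rpow hpos.le hδ0, ← mul_assoc (N ^ (1 - α)), ← Real.rpow_add hpos,
      sub_add_cancel, Real.rpow_one]
    calc ∑ i, |v i - N * youngDual q (ζ i)| = ∑ i, N * |v i / N - youngDual q (ζ i)| := by
          refine Finset.sum_congr rfl fun i _ => ?_
          nth_rewrite 2 [← abs_of_pos hpos]
          rw [← abs_mul, mul_sub, mul_div_cancel₀ _ hpos.ne']
      _ ≤ ∑ i, N * (C i * δ ^ α) := by
          gcongr with i
          exact hCv i _ hw
      _ = (∑ i, C i) * (N * δ ^ α) := by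
          rw [Finset.sum_mul]; exact Finset.sum_congr rfl fun i _ => by ring
      _ ≤ _ := by
          have : 0 ≤ N * δ ^ α := by positivity
          nlinarith

end Vector

/-! ### Distance from a point of the cone to the exposed ray. -/

/-- A generator of the ray exposed in the `p`-cone by a boundary point `z` of the `q`-cone. -/
noncomputable def exposedRay {n : ℕ} (q : ℝ) (z : EuclideanSpace ℝ (Fin (n + 1))) :
    EuclideanSpace ℝ (Fin (n + 1)) :=
  WithLp.toLp 2 (Fin.cons 1 fun i => -youngDual q (z i.succ / z 0))

section Cone

variable {n : ℕ} {p q : ℝ}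

@[simp] lemma exposedRay_zero (z : EuclideanSpace ℝ (Fin (n + 1))) : exposedRay q z 0 = 1 := rfl

@[simp] lemma exposedRay_succ (z : EuclideanSpace ℝ (Fin (n + 1))) (i : Fin n) :
    exposedRay q z i.succ = -youngDual q (z i.succ / z 0) := rfl

lemma tailPNorm_nonneg (p : ℝ) (x : EuclideanSpace ℝ (Fin (n + 1))) : 0 ≤ tailPNorm p x :=
  Real.rpow_nonneg (Finset.sum_nonneg fun _ _ => Real.rpow_nonneg (abs_nonneg _) _) _

lemma norm_le_sum_abs {ι : Type*} [Fintype ι] (x : EuclideanSpace ℝ ι) : ‖x‖ ≤ ∑ i, |x i| := by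
  rw [EuclideanSpace.norm_eq]
  refine Real.sqrt_le_iff.2 ⟨by positivity, ?_⟩
  simp only [Real.norm_eq_abs]
  exact Finset.sum_sq_le_sq_sum_of_nonneg fun i _ => abs_nonneg _

lemma inner_eq_zero_coord_mul (z x : EuclideanSpace ℝ (Fin (n + 1))) (hz : z 0 ≠ 0) :
    inner ℝ z x = z 0 * (x 0 + ∑ i : Fin n, z i.succ / z 0 * x i.succ) := by
  rw [PiLp.inner_apply, Fin.sum_univ_succ, mul_add, Finset.mul_sum]
  simp only [RCLike.inner_apply, conj_trivial]
  congr 1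
  · ring
  · refine Finset.sum_congr rfl fun i _ => ?_
    field_simp

lemma sum_div_rpow_eq_one (hq : 0 < q) {z : EuclideanSpace ℝ (Fin (n + 1))} (hz0 : 0 < z 0)
    (hz : tailPNorm q z = z 0) : ∑ i : Fin n, |z i.succ / z 0| ^ q = 1 := by
  have hS : 0 ≤ ∑ i : Fin n, |z i.succ| ^ q := Finset.sum_nonneg fun i _ => by positivity
  have h1 : (z 0) ^ q = ∑ i : Fin n, |z i.succ| ^ q := by
    rw [← hz, tailPNorm, ← Real.rpow_mul hS, one_div_mul_cancel hq.ne', Real.rpow_one]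
  simp only [abs_div, abs_of_pos hz0, Real.div_rpow (abs_nonneg _) hz0.le, ← Finset.sum_div]
  rw [← h1, div_self (by positivity)]

/-- With `N = tailPNorm p y`, the quantity `⟪z, y⟫ / z 0` splits into two nonnegative parts: `y 0 -
N`, the error in coordinate zero against `N • exposedRay q z`, and the Hölder defect `N + σ`, which
controls the other coordinates. The bound `R` is needed for the factors of exponent `1 - α`. -/
lemma exists_norm_sub_exposedRay_le (h : p.HolderConjugate q)
    {z : EuclideanSpace ℝ (Fin (n + 1))} (hz0 : 0 < z 0) (hz : tailPNorm q z = z 0) {α : ℝ}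
    (hα : 0 < α) (hα1 : α ≤ 1) (hzero : ∀ i : Fin n, z i.succ = 0 → α ≤ 1 / p)
    (hhalf : α ≤ 1 / 2 ∨ ∃ j : Fin n, ∀ i, i ≠ j → z i.succ = 0) (R : ℝ) :
    ∃ C : ℝ, 0 < C ∧ ∀ y ∈ pCone n p, ‖y‖ ≤ R →
      ∃ t : ℝ, 0 ≤ t ∧ ‖y - t • exposedRay q z‖ ≤ C * (inner ℝ z y) ^ α := by
  have hζ := sum_div_rpow_eq_one h.symm.pos hz0 hz
  obtain ⟨C, hC, hCv⟩ := exists_sum_abs_sub_youngDual_le h hζ hα hα1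
    (fun i hi => hzero i (by simpa [hz0.ne'] using hi))
    (hhalf.imp id fun ⟨j, hj⟩ => ⟨j, fun i hi => by simp [hj i hi]⟩)
  have hD : 0 < ((2 * |R|) ^ (1 - α) + C * |R| ^ (1 - α) + 1) / z 0 ^ α := by positivity
  refine ⟨_, hD, fun y hy hyR => ⟨tailPNorm p y, tailPNorm_nonneg p y, ?_⟩⟩
  set N := tailPNorm p y with hN
  have hN0 : 0 ≤ N := tailPNorm_nonneg p y
  have hNy : N ≤ y 0 := hy
  have hyR' : y 0 ≤ |R| := ((le_abs_self _).trans (PiLp.norm_apply_le y 0)).trans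
    (hyR.trans (le_abs_self R))
  have hv := hCv (fun i => -y i.succ) N (by simp [hN, tailPNorm])
  simp only [mul_neg, Finset.sum_neg_distrib, sub_neg_eq_add] at hv
  set σ := ∑ i : Fin n, z i.succ / z 0 * y i.succ with hσ
  have hhol : |σ| ≤ N := by
    have h1 := Real.inner_le_Lp_mul_Lq Finset.univ (fun i : Fin n => y i.succ)
      (fun i => z i.succ / z 0) h
    have h2 := Real.inner_le_Lp_mul_Lq Finset.univ (fun i : Fin n => -y i.succ)
      (fun i => z i.succ / z 0) h
    simp only [abs_neg, hζ, Real.one_rpow, mul_one, neg_mul, Finset.sum_neg_distrib] at h1 h2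
    simp only [mul_comm (y _)] at h1 h2
    exact abs_le.2 ⟨by linarith [show -σ ≤ N from h2], h1⟩
  obtain ⟨hσ1, hσ2⟩ := abs_le.1 hhol
  rw [inner_eq_zero_coord_mul z y hz0.ne', ← hσ]
  set s := y 0 + σ with hs
  have hs0 : 0 ≤ s := by linarith
  have hs2 : s ≤ 2 * |R| := by linarith
  rw [Real.mul_rpow hz0.le hs0, ← mul_assoc, div_mul_cancel₀ _ (by positivity)]
  have hsum : ∑ i : Fin n, |y i.succ + N * youngDual q (z i.succ / z 0)| ≤
      C * |R| ^ (1 - α) * s ^ α := by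
    calc _ = ∑ i : Fin n, |-y i.succ - N * youngDual q (z i.succ / z 0)| :=
          Finset.sum_congr rfl fun i _ => by rw [← abs_neg]; ring_nf
      _ ≤ C * (N ^ (1 - α) * (N + σ) ^ α) := hv
      _ ≤ C * (|R| ^ (1 - α) * s ^ α) := by
          have h1 : N ^ (1 - α) ≤ |R| ^ (1 - α) :=
            Real.rpow_le_rpow hN0 (by linarith) (by linarith)
          have h2 : (N + σ) ^ α ≤ s ^ α :=
            Real.rpow_le_rpow (by linarith) (by linarith) hα.le
          have h3 : 0 ≤ (N + σ) ^ α := Real.rpow_nonneg (by linarith) _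
          gcongr
      _ = _ := by ring
  have hsα : s ≤ (2 * |R|) ^ (1 - α) * s ^ α := by
    calc s = s ^ (1 - α) * s ^ α := by
          rw [← Real.rpow_add_of_nonneg hs0 (by linarith) hα.le, sub_add_cancel, Real.rpow_one]
      _ ≤ _ := by
          gcongr
  refine (norm_le_sum_abs _).trans ?_
  rw [Fin.sum_univ_succ]
  simp only [PiLp.sub_apply, PiLp.smul_apply, exposedRay_zero, exposedRay_succ, smul_eq_mul,
    mul_one, mul_neg, sub_neg_eq_add]
  rw [abs_of_nonneg (by linarith)]
  have : 0 ≤ s ^ α := by positivity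
  linarith

end Cone

/-! ### Error bounds for general closed sets, cones and rays. -/

section ErrorBounds

variable {E : Type*} [NormedAddCommGroup E] [InnerProductSpace ℝ E] [FiniteDimensional ℝ E]

lemma isClosed_mk' (a : E) (L : Submodule ℝ E) : IsClosed (AffineSubspace.mk' a L : Set E) := by
  have h : (AffineSubspace.mk' a L : Set E) = (fun x => x - a) ⁻¹' (L : Set E) := by
    ext x; simp [AffineSubspace.mem_mk']
  rw [h]
  exact L.closed_of_finiteDimensional.preimage (by fun_prop)

/-- A Slater point gives a Lipschitzian error bound. -/
lemma lipschitzErrorBound_of_mem_interior {K A : Set E} (hK : Convex ℝ K) (hKc : IsClosed K)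
    (hA : Convex ℝ A) (hAc : IsClosed A) {x₀ : E} (hx₀A : x₀ ∈ A) (hx₀ : x₀ ∈ interior K) :
    LipschitzErrorBound K A := by
  have := FiniteDimensional.proper ℝ E
  refine ⟨one_pos, le_rfl, fun B hB => ?_⟩
  obtain ⟨r, hr, hball⟩ := Metric.nhds_basis_closedBall.mem_iff.1 (mem_interior_iff_mem_nhds.1 hx₀)
  have hx₀K := interior_subset hx₀
  obtain ⟨R, hR, hBR⟩ := hB.subset_closedBall_lt 0 x₀
  refine ⟨1 + 4 * R / r, by positivity, fun x hx => ?_⟩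
  rw [Real.rpow_one]
  set ε := max (Metric.infDist x K) (Metric.infDist x A) with hε
  have hxR : ‖x - x₀‖ ≤ R := by simpa [dist_eq_norm] using hBR hx
  obtain ⟨y, hyK, hy⟩ := hKc.exists_infDist_eq_dist ⟨x₀, hx₀K⟩ x
  obtain ⟨w, hwA, hw⟩ := hAc.exists_infDist_eq_dist ⟨x₀, hx₀A⟩ x
  have hyε : ‖x - y‖ ≤ ε := by rw [← dist_eq_norm, ← hy]; exact le_max_left _ _
  have hwε : ‖x - w‖ ≤ ε := by rw [← dist_eq_norm, ← hw]; exact le_max_right _ _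
  have hε0 : 0 ≤ ε := (norm_nonneg _).trans hyε
  have hεR : ε ≤ R := by
    refine max_le ?_ ?_
    · exact (Metric.infDist_le_dist_of_mem hx₀K).trans (by rwa [dist_eq_norm])
    · exact (Metric.infDist_le_dist_of_mem hx₀A).trans (by rwa [dist_eq_norm])
  have hwy : ‖w - y‖ ≤ 2 * ε := by
    calc ‖w - y‖ = ‖(x - y) - (x - w)‖ := by congr 1; abel
      _ ≤ ‖x - y‖ + ‖x - w‖ := norm_sub_le _ _
      _ ≤ _ := by linarith
  have hwx₀ : ‖w - x₀‖ ≤ 2 * R := by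
    calc ‖w - x₀‖ = ‖(x - x₀) - (x - w)‖ := by congr 1; abel
      _ ≤ ‖x - x₀‖ + ‖x - w‖ := norm_sub_le _ _
      _ ≤ _ := by linarith
  -- Chosen so that `(1 - lam) / lam * (2 * ε) = r`: the combination of `w` and `x₀` is then also a
  -- combination of `y` and a point of the ball of radius `r` about `x₀`, hence lies in `K`.
  set lam := 2 * ε / (2 * ε + r)
  have hlam0 : 0 ≤ lam := by positivity
  have hlam1 : 1 - lam = r / (2 * ε + r) := by simp only [lam]; field_simp; ring
  have hlam1' : 0 ≤ 1 - lam := by rw [hlam1]; positivity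
  have hlamr : lam ≤ 2 * ε / r := by simp only [lam]; gcongr; linarith
  have hmemA : (1 - lam) • w + lam • x₀ ∈ A := hA hwA hx₀A hlam1' hlam0 (by ring)
  have hmemK : (1 - lam) • w + lam • x₀ ∈ K := by
    rcases hε0.eq_or_lt with h0 | hpos
    · have hw0 : w = y := by
        rw [← sub_eq_zero, ← norm_eq_zero]
        exact le_antisymm (by linarith) (norm_nonneg _)
      simpa [lam, ← h0, hw0] using hyK
    · have hlampos : 0 < lam := by positivity
      have hb : x₀ + ((1 - lam) / lam) • (w - y) ∈ K := by
        apply hball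
        rw [Metric.mem_closedBall, dist_eq_norm, add_sub_cancel_left, norm_smul, Real.norm_eq_abs,
          abs_of_nonneg (by positivity)]
        have : (1 - lam) / lam = r / (2 * ε) := by rw [hlam1]; simp only [lam]; field_simp
        rw [this]
        calc r / (2 * ε) * ‖w - y‖ ≤ r / (2 * ε) * (2 * ε) := by gcongr
          _ = r := by field_simp
      have := hK hyK hb hlam1' hlam0 (by ring)
      rw [smul_add, smul_smul, mul_div_cancel₀ _ hlampos.ne', smul_sub] at this
      convert! this using 1
      abel
  have hmem : (1 - lam) • w + lam • x₀ ∈ K ∩ A := ⟨hmemK, hmemA⟩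
  refine (Metric.infDist_le_dist_of_mem hmem).trans ?_
  rw [dist_eq_norm]
  calc ‖x - ((1 - lam) • w + lam • x₀)‖ = ‖(x - w) + lam • (w - x₀)‖ := by
        congr 1; module
    _ ≤ ‖x - w‖ + lam * ‖w - x₀‖ := by
        refine (norm_add_le _ _).trans ?_
        rw [norm_smul, Real.norm_eq_abs, abs_of_nonneg hlam0]
    _ ≤ ε + 2 * ε / r * (2 * R) := by gcongr
    _ = _ := by ring

/-- A closed cone meeting a linear subspace only at the origin satisfies a Lipschitzian error
bound with it. -/
lemma lipschitzErrorBound_of_inter_eq_zero {K : Set E} (hKc : IsClosed K)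
    (hK : ∀ x ∈ K, ∀ t : ℝ, 0 ≤ t → t • x ∈ K) (L : Submodule ℝ E) (hKL : K ∩ L = {0}) :
    LipschitzErrorBound K L := by
  have := FiniteDimensional.proper ℝ E
  have h0 : (0 : E) ∈ K ∩ L := by rw [hKL]; rfl
  -- By compactness the distance to `L` has a positive minimum on the unit vectors of `K`;
  -- homogeneity extends the bound to all of `K`.
  obtain ⟨m, hm, hmK⟩ : ∃ m : ℝ, 0 < m ∧ ∀ y ∈ K, ∀ l ∈ L, m * ‖y‖ ≤ ‖y - l‖ := by
    have hcomp : IsCompact (K ∩ Metric.sphere 0 1) := (isCompact_sphere 0 1).inter_left hKc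
    rcases (K ∩ Metric.sphere (0 : E) 1).eq_empty_or_nonempty with hem | hne
    · refine ⟨1, one_pos, fun y hy l _ => ?_⟩
      have hy0 : y = 0 := by
        by_contra hy0
        have : ‖y‖⁻¹ • y ∈ K ∩ Metric.sphere (0 : E) 1 :=
          ⟨hK y hy _ (by positivity), by simp [norm_smul, hy0]⟩
        rw [hem] at this
        exact this
      simp [hy0]
    · obtain ⟨y₀, ⟨hy₀K, hy₀s⟩, hmin⟩ := hcomp.exists_isMinOn hne
        (Metric.continuous_infDist_pt (L : Set E)).continuousOn
      have hLne : (L : Set E).Nonempty := ⟨0, h0.2⟩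
      refine ⟨Metric.infDist y₀ L, ?_, fun y hy l hl => ?_⟩
      · refine (L.closed_of_finiteDimensional.notMem_iff_infDist_pos hLne).1 fun hmem => ?_
        have : y₀ ∈ K ∩ L := ⟨hy₀K, hmem⟩
        rw [hKL, Set.mem_singleton_iff] at this
        simp [this] at hy₀s
      · rcases eq_or_ne y 0 with rfl | hy0
        · simp
        · have hy' : 0 < ‖y‖ := norm_pos_iff.2 hy0
          have h1 : Metric.infDist y₀ L ≤ Metric.infDist (‖y‖⁻¹ • y) L :=
            hmin ⟨hK y hy _ (by positivity), by simp [norm_smul, hy0]⟩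
          have h2 := h1.trans (Metric.infDist_le_dist_of_mem (L.smul_mem ‖y‖⁻¹ hl))
          rw [dist_eq_norm, ← smul_sub, norm_smul, norm_inv, norm_norm, inv_mul_eq_div,
            le_div_iff₀ hy'] at h2
          exact h2
  refine ⟨one_pos, le_rfl, fun B _ => ⟨1 + 2 / m, by positivity, fun x _ => ?_⟩⟩
  rw [Real.rpow_one, hKL, Metric.infDist_singleton, dist_zero_right]
  set ε := max (Metric.infDist x K) (Metric.infDist x L)
  obtain ⟨y, hyK, hy⟩ := hKc.exists_infDist_eq_dist ⟨0, h0.1⟩ x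
  obtain ⟨w, hwL, hw⟩ := L.closed_of_finiteDimensional.exists_infDist_eq_dist ⟨0, h0.2⟩ x
  have hyε : ‖x - y‖ ≤ ε := by rw [← dist_eq_norm, ← hy]; exact le_max_left _ _
  have hwε : ‖x - w‖ ≤ ε := by rw [← dist_eq_norm, ← hw]; exact le_max_right _ _
  have hyw : ‖y - w‖ ≤ 2 * ε := by
    calc ‖y - w‖ = ‖(x - w) - (x - y)‖ := by congr 1; abel
      _ ≤ ‖x - w‖ + ‖x - y‖ := norm_sub_le _ _
      _ ≤ _ := by linarith
  have hyn : ‖y‖ ≤ 2 * ε / m := by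
    rw [le_div_iff₀ hm, mul_comm]
    exact (hmK y hyK w hwL).trans hyw
  calc ‖x‖ = ‖(x - y) + y‖ := by congr 1; abel
    _ ≤ ‖x - y‖ + ‖y‖ := norm_add_le _ _
    _ ≤ ε + 2 * ε / m := by linarith
    _ = _ := by ring

/-- A linear error bound for the intersection of a ray with an affine subspace. -/
lemma exists_infDist_ray_inter_le (f a : E) (L : Submodule ℝ E) {t₀ : ℝ} (ht₀ : 0 ≤ t₀)
    (hmem : t₀ • f ∈ AffineSubspace.mk' a L) {S : Set E}
    (hS : ∀ t : ℝ, 0 ≤ t → t • f ∈ AffineSubspace.mk' a L → t • f ∈ S) :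
    ∃ C : ℝ, 0 < C ∧ ∀ x : E, ∀ t : ℝ, 0 ≤ t → ∀ b ∈ AffineSubspace.mk' a L,
      Metric.infDist x S ≤ C * (‖x - t • f‖ + ‖x - b‖) := by
  have hLc : IsClosed (L : Set E) := L.closed_of_finiteDimensional
  have hLne : (L : Set E).Nonempty := ⟨0, L.zero_mem⟩
  rw [AffineSubspace.mem_mk', vsub_eq_sub] at hmem
  -- Either the whole ray lies in the affine subspace, or it meets it only at `t₀ • f` and leaves it
  -- at rate `Metric.infDist f L`.
  by_cases hf : f ∈ L
  · refine ⟨1, one_pos, fun x t ht b _ => ?_⟩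
    have h1 : t • f ∈ S := by
      refine hS t ht ?_
      rw [AffineSubspace.mem_mk', vsub_eq_sub]
      have := L.add_mem hmem (L.smul_mem (t - t₀) hf)
      convert! this using 1
      module
    have h2 := Metric.infDist_le_dist_of_mem (x := x) h1
    rw [dist_eq_norm] at h2
    have := norm_nonneg (x - b)
    linarith
  · have hm := (hLc.notMem_iff_infDist_pos hLne).1 hf
    set m := Metric.infDist f L
    refine ⟨1 + ‖f‖ / m, by positivity, fun x t ht b hb => ?_⟩
    rw [AffineSubspace.mem_mk', vsub_eq_sub] at hb
    have h1 : t₀ • f ∈ S := hS t₀ ht₀ (by rwa [AffineSubspace.mem_mk', vsub_eq_sub])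
    have h2 := Metric.infDist_le_dist_of_mem (x := x) h1
    rw [dist_eq_norm] at h2
    have h3 : |t - t₀| * m ≤ ‖t • f - b‖ := by
      rcases eq_or_ne t t₀ with rfl | hne
      · simp
      · have hne' : t - t₀ ≠ 0 := sub_ne_zero.2 hne
        have hl : (t - t₀)⁻¹ • (b - t₀ • f) ∈ L := by
          refine L.smul_mem _ ?_
          have := L.sub_mem hb hmem
          rwa [sub_sub_sub_cancel_right] at this
        have h4 := Metric.infDist_le_dist_of_mem (x := f) hl
        rw [dist_eq_norm] at h4
        calc |t - t₀| * m ≤ |t - t₀| * ‖f - (t - t₀)⁻¹ • (b - t₀ • f)‖ := by gcongr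
          _ = ‖(t - t₀) • (f - (t - t₀)⁻¹ • (b - t₀ • f))‖ := by
              rw [norm_smul, Real.norm_eq_abs]
          _ = ‖t • f - b‖ := by
              rw [smul_sub, smul_inv_smul₀ hne']
              congr 1
              module
    have h5 : ‖t • f - b‖ ≤ ‖x - t • f‖ + ‖x - b‖ := by
      calc ‖t • f - b‖ = ‖(x - b) - (x - t • f)‖ := by congr 1; abel
        _ ≤ ‖x - b‖ + ‖x - t • f‖ := norm_sub_le _ _
        _ = _ := add_comm _ _
    have h6 : |t - t₀| ≤ (‖x - t • f‖ + ‖x - b‖) / m := by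
      rw [le_div_iff₀ hm]; exact h3.trans h5
    refine h2.trans ?_
    calc ‖x - t₀ • f‖ = ‖(x - t • f) + (t - t₀) • f‖ := by congr 1; module
      _ ≤ ‖x - t • f‖ + |t - t₀| * ‖f‖ := by
          refine (norm_add_le _ _).trans ?_
          rw [norm_smul, Real.norm_eq_abs]
      _ ≤ (‖x - t • f‖ + ‖x - b‖) + (‖x - t • f‖ + ‖x - b‖) / m * ‖f‖ := by
          gcongr
          exact le_add_of_nonneg_right (norm_nonneg _)
      _ = _ := by ring

end ErrorBounds

lemma intrinsicInterior_subset_interior {E : Type*} [NormedAddCommGroup E]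
    [NormedSpace ℝ E] {s : Set E} (hs : (interior s).Nonempty) :
    intrinsicInterior ℝ s ⊆ interior s := by
  have htop : affineSpan ℝ s = ⊤ :=
    top_unique ((isOpen_interior.affineSpan_eq_top hs).symm.le.trans
      (affineSpan_mono ℝ interior_subset))
  rintro x hx
  obtain ⟨y, hy, rfl⟩ := mem_intrinsicInterior.1 hx
  rw [mem_interior_iff_mem_nhds] at hy ⊢
  have hopen : IsOpen ((affineSpan ℝ s : Set E)) := by rw [htop]; exact isOpen_univ
  have := hopen.isOpenEmbedding_subtypeVal.image_mem_nhds.2 hy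
  exact Filter.mem_of_superset this (Set.image_preimage_subset _ _)

/-! ### Geometry and duality of the `p`-cone, and supporting hyperplanes. -/

section ConeGeometry

variable {n : ℕ} {p q : ℝ}

lemma continuous_tailPNorm (hp : 0 < p) :
    Continuous (tailPNorm p : EuclideanSpace ℝ (Fin (n + 1)) → ℝ) := by
  unfold tailPNorm
  refine Continuous.rpow_const ?_ fun _ => Or.inr (by positivity)
  refine continuous_finsetSum _ fun i _ => Continuous.rpow_const ?_ fun _ => Or.inr hp.le
  fun_prop

lemma tailPNorm_smul (hp : 0 < p) {t : ℝ} (ht : 0 ≤ t) (x : EuclideanSpace ℝ (Fin (n + 1))) :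
    tailPNorm p (t • x) = t * tailPNorm p x := by
  simp only [tailPNorm, PiLp.smul_apply, smul_eq_mul, abs_mul, abs_of_nonneg ht,
    Real.mul_rpow ht (abs_nonneg _), ← Finset.mul_sum]
  rw [Real.mul_rpow (by positivity) (Finset.sum_nonneg fun i _ => by positivity),
    ← Real.rpow_mul ht, mul_one_div_cancel hp.ne', Real.rpow_one]

lemma tailPNorm_add_le (hp : 1 ≤ p) (x y : EuclideanSpace ℝ (Fin (n + 1))) :
    tailPNorm p (x + y) ≤ tailPNorm p x + tailPNorm p y := by
  simpa [tailPNorm] using Real.Lp_add_le Finset.univ (fun i : Fin n => x i.succ)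
    (fun i => y i.succ) hp

lemma isClosed_pCone (hp : 0 < p) : IsClosed (pCone n p) :=
  isClosed_le (continuous_tailPNorm hp) (by fun_prop)

lemma smul_mem_pCone (hp : 0 < p) {x : EuclideanSpace ℝ (Fin (n + 1))} (hx : x ∈ pCone n p)
    {t : ℝ} (ht : 0 ≤ t) : t • x ∈ pCone n p := by
  change tailPNorm p (t • x) ≤ t * x 0
  rw [tailPNorm_smul hp ht]
  exact mul_le_mul_of_nonneg_left hx ht

lemma convex_pCone (hp : 1 ≤ p) : Convex ℝ (pCone n p) := by
  intro x hx y hy a b ha hb _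
  have hp0 : 0 < p := by linarith
  refine (tailPNorm_add_le hp _ _).trans ?_
  exact add_le_add (smul_mem_pCone hp0 hx ha) (smul_mem_pCone hp0 hy hb)

lemma mem_interior_pCone (hp : 0 < p) {x : EuclideanSpace ℝ (Fin (n + 1))}
    (hx : tailPNorm p x < x 0) : x ∈ interior (pCone n p) := by
  have ho : IsOpen {x : EuclideanSpace ℝ (Fin (n + 1)) | tailPNorm p x < x 0} :=
    isOpen_lt (continuous_tailPNorm hp) (by fun_prop)
  exact interior_maximal (fun y (hy : tailPNorm p y < y 0) => hy.le) ho hx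

lemma interior_pCone_nonempty (hp : 0 < p) : (interior (pCone n p)).Nonempty := by
  refine ⟨EuclideanSpace.single 0 1, mem_interior_pCone hp ?_⟩
  simp [tailPNorm, Real.zero_rpow hp.ne', Real.zero_rpow (inv_ne_zero hp.ne')]

lemma tailPNorm_eq_of_mem_frontier (hp : 0 < p) {z : EuclideanSpace ℝ (Fin (n + 1))}
    (hz : z ∈ frontier (pCone n p)) : tailPNorm p z = z 0 :=
  frontier_le_subset_eq (continuous_tailPNorm hp) (by fun_prop) hz

lemma pos_of_tailPNorm_eq (hp : 0 < p) {z : EuclideanSpace ℝ (Fin (n + 1))}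
    (hz : tailPNorm p z = z 0) (hz0 : z ≠ 0) : 0 < z 0 := by
  have hS : 0 ≤ ∑ i : Fin n, |z i.succ| ^ p := Finset.sum_nonneg fun i _ => by positivity
  refine lt_of_le_of_ne (hz ▸ tailPNorm_nonneg p z) fun h => hz0 ?_
  rw [← h, tailPNorm, Real.rpow_eq_zero hS (by positivity)] at hz
  ext i
  refine Fin.cases h.symm (fun i => ?_) i
  have := (Finset.sum_eq_zero_iff_of_nonneg (fun i _ => by positivity)).1 hz i (Finset.mem_univ i)
  simpa using (Real.rpow_eq_zero (abs_nonneg _) hp.ne').1 this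

lemma inner_eq_coord (z x : EuclideanSpace ℝ (Fin (n + 1))) :
    inner ℝ z x = z 0 * x 0 + ∑ i : Fin n, z i.succ * x i.succ := by
  simp [PiLp.inner_apply, Fin.sum_univ_succ, mul_comm]

lemma inner_nonneg_of_mem_pCone (h : p.HolderConjugate q) {z x : EuclideanSpace ℝ (Fin (n + 1))}
    (hz : z ∈ pCone n q) (hx : x ∈ pCone n p) : 0 ≤ inner ℝ z x := by
  rw [inner_eq_coord]
  have h1 := Real.inner_le_Lp_mul_Lq Finset.univ (fun i : Fin n => -z i.succ)
    (fun i => x i.succ) h.symm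
  simp only [abs_neg, neg_mul, Finset.sum_neg_distrib] at h1
  have h2 : tailPNorm q z * tailPNorm p x ≤ z 0 * x 0 :=
    mul_le_mul hz hx (tailPNorm_nonneg p x) ((tailPNorm_nonneg q z).trans hz)
  unfold tailPNorm at h2
  linarith

/-- Test against the vector giving equality in Hölder's inequality: its tail is minus the Young dual
of the tail of `z`. If that tail is zero, the axis vector suffices. -/
lemma mem_pCone_of_inner_nonneg (h : p.HolderConjugate q) {z : EuclideanSpace ℝ (Fin (n + 1))}
    (hz : ∀ x ∈ pCone n p, 0 ≤ inner ℝ z x) : z ∈ pCone n q := by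
  have hq := h.symm.pos
  set S := ∑ i : Fin n, |z i.succ| ^ q with hSdef
  have hS : 0 ≤ S := Finset.sum_nonneg fun i _ => by positivity
  change S ^ (1 / q) ≤ z 0
  rcases hS.eq_or_lt with h0 | hpos
  · rw [← h0, Real.zero_rpow (by positivity)]
    have := hz (EuclideanSpace.single 0 1) (interior_subset (mem_interior_pCone h.pos (by
      simp [tailPNorm, Real.zero_rpow h.ne_zero, Real.zero_rpow (inv_ne_zero h.ne_zero)])))
    rw [inner_eq_coord] at this
    simpa using this
  · have hx := hz (WithLp.toLp 2 (Fin.cons (S ^ (1 / p)) fun i => -youngDual q (z i.succ)))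
      (by simp [pCone, tailPNorm, abs_youngDual_rpow h, ← hSdef])
    rw [inner_eq_coord] at hx
    simp only [Fin.cons_zero, Fin.cons_succ, mul_neg, mul_youngDual h.symm.lt,
      Finset.sum_neg_distrib, ← hSdef] at hx
    have h1 : S ^ (1 / q) * S ^ (1 / p) = S := by
      rw [← Real.rpow_add hpos]
      have : 1 / q + 1 / p = 1 := by simpa using h.symm.inv_add_inv_eq_one
      rw [this, Real.rpow_one]
    have h2 : 0 < S ^ (1 / p) := by positivity
    refine le_of_mul_le_mul_right ?_ h2
    linarith

/-- From an interior `z` one could move slightly to `z - t • x` inside the cone, whose pairing with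
`x` is `-t * ‖x‖ ^ 2 < 0`. -/
lemma notMem_interior_pCone_of_inner_eq_zero (h : p.HolderConjugate q)
    {z x : EuclideanSpace ℝ (Fin (n + 1))} (hx : x ∈ pCone n p) (hx0 : x ≠ 0)
    (hzx : inner ℝ z x = 0) : z ∉ interior (pCone n q) := by
  intro hz
  have hc : ContinuousAt (fun t : ℝ => z - t • x) 0 := by fun_prop
  have hev : ∀ᶠ t in nhds (0 : ℝ), z - t • x ∈ pCone n q := by
    refine hc.eventually ?_
    simpa using mem_interior_iff_mem_nhds.1 hz
  obtain ⟨ε, hε, hball⟩ := Metric.eventually_nhds_iff.1 hev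
  have h1 := inner_nonneg_of_mem_pCone h
    (hball (y := ε / 2) (by simp [abs_of_pos hε, hε])) hx
  rw [inner_sub_left, hzx, real_inner_smul_left, real_inner_self_eq_norm_sq] at h1
  have : 0 < ‖x‖ := norm_pos_iff.2 hx0
  have : 0 < ε / 2 * ‖x‖ ^ 2 := by positivity
  linarith

/-- If an affine subspace meets the `p`-cone, but neither in its interior nor only at the origin,
then a boundary point of the `q`-cone supports it. -/
lemma exists_frontier_supporting (h : p.HolderConjugate q)
    (L : Submodule ℝ (EuclideanSpace ℝ (Fin (n + 1)))) (a : EuclideanSpace ℝ (Fin (n + 1)))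
    (hne : ((AffineSubspace.mk' a L : Set (EuclideanSpace ℝ (Fin (n + 1)))) ∩ pCone n p).Nonempty)
    (h0 : (AffineSubspace.mk' a L : Set (EuclideanSpace ℝ (Fin (n + 1)))) ∩ pCone n p ≠ {0})
    (hint : Disjoint (interior (pCone n p))
      (AffineSubspace.mk' a L : Set (EuclideanSpace ℝ (Fin (n + 1))))) :
    ∃ z ∈ frontier (pCone n q), z ∈ Lᗮ ∧ inner ℝ z a = 0 ∧ z ≠ 0 := by
  have hconv := convex_pCone (n := n) h.lt.le
  obtain ⟨f, u, hf, hu⟩ := geometric_hahn_banach_open hconv.interior isOpen_interior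
    (AffineSubspace.mk' a L).convex hint
  have hfK : ∀ x ∈ pCone n p, f x ≤ u := by
    intro x hx
    have h1 : x ∈ closure (interior (pCone n p)) := by
      rw [hconv.closure_interior_eq_closure_of_nonempty_interior (interior_pCone_nonempty h.pos)]
      exact subset_closure hx
    exact closure_minimal (fun y hy => (hf y hy).le)
      (isClosed_le f.continuous continuous_const) h1
  have hu0 : 0 ≤ u := by
    have hm : (0 : EuclideanSpace ℝ (Fin (n + 1))) ∈ pCone n p := by
      simp [pCone, tailPNorm, Real.zero_rpow h.ne_zero, Real.zero_rpow (inv_ne_zero h.ne_zero)]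
    simpa using hfK 0 hm
  have hfK0 : ∀ x ∈ pCone n p, f x ≤ 0 := by
    intro x hx
    by_contra hpos
    have hpos : 0 < f x := not_le.1 hpos
    -- At this multiple `f` takes the value `u + f x > u`.
    have := hfK ((u / f x + 1) • x) (smul_mem_pCone h.pos hx (by positivity))
    rw [map_smul, smul_eq_mul, add_mul, div_mul_cancel₀ _ hpos.ne'] at this
    linarith
  have hmem : ∀ l ∈ L, l + a ∈ AffineSubspace.mk' a L := by
    intro l hl
    simpa [AffineSubspace.mem_mk'] using hl
  have hfL : ∀ l ∈ L, f l = 0 := by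
    intro l hl
    by_contra hne
    -- The multiplier makes `f` equal to `u - 1` at a point of the affine subspace.
    have := hu _ (hmem _ (L.smul_mem ((u - f a - 1) / f l) hl))
    rw [map_add, map_smul, smul_eq_mul, div_mul_cancel₀ _ hne] at this
    linarith
  have hfa : ∀ x ∈ AffineSubspace.mk' a L, f x = f a := by
    intro x hx
    have := hfL _ (AffineSubspace.mem_mk'.1 hx)
    rwa [vsub_eq_sub, map_sub, sub_eq_zero] at this
  obtain ⟨x₁, hx₁A, hx₁K⟩ := hne
  have hfa0 : f a = 0 := by
    refine le_antisymm ?_ (hu0.trans (hu a (AffineSubspace.self_mem_mk' a L)))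
    rw [← hfa x₁ hx₁A]
    exact hfK0 x₁ hx₁K
  obtain ⟨x, ⟨hxA, hxK⟩, hx0⟩ : ∃ x ∈ (AffineSubspace.mk' a L :
      Set (EuclideanSpace ℝ (Fin (n + 1)))) ∩ pCone n p, x ≠ 0 := by
    by_contra! hall
    refine h0 (Set.eq_singleton_iff_nonempty_unique_mem.2 ⟨⟨x₁, hx₁A, hx₁K⟩, hall⟩)
  set z := -(InnerProductSpace.toDual ℝ _).symm f with hz
  have hzf : ∀ y, inner ℝ z y = -f y := by
    intro y
    rw [hz, inner_neg_left, InnerProductSpace.toDual_symm_apply]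
  have hzq : z ∈ pCone n q := mem_pCone_of_inner_nonneg h fun y hy => by
    rw [hzf]; linarith [hfK0 y hy]
  refine ⟨z, ⟨subset_closure hzq, notMem_interior_pCone_of_inner_eq_zero h hxK hx0 ?_⟩, ?_, ?_, ?_⟩
  · rw [hzf, hfa x hxA, hfa0, neg_zero]
  · rw [Submodule.mem_orthogonal]
    intro l hl
    rw [real_inner_comm, hzf, hfL l hl, neg_zero]
  · rw [hzf, hfa0, neg_zero]
  · intro hz0
    obtain ⟨y, hy⟩ := interior_pCone_nonempty (n := n) h.pos
    have h1 := hf y hy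
    have h2 := hu a (AffineSubspace.self_mem_mk' a L)
    have h3 := hzf y
    rw [hz0, inner_zero_left] at h3
    linarith

end ConeGeometry

/-! ### What the exponent encodes. -/

section Exponent

variable {n : ℕ} {p q : ℝ}

lemma min_le_pExponent (p : ℝ) (z : EuclideanSpace ℝ (Fin (n + 1))) :
    min (1 / 2) (1 / p) ≤ pExponent p z := by
  unfold pExponent
  split_ifs
  · exact min_le_left _ _
  · exact min_le_right _ _
  · exact le_rfl

lemma pExponent_pos (hp : 0 < p) (z : EuclideanSpace ℝ (Fin (n + 1))) : 0 < pExponent p z :=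
  lt_of_lt_of_le (lt_min (by norm_num) (by positivity)) (min_le_pExponent p z)

lemma pExponent_le_one (hp : 1 < p) (z : EuclideanSpace ℝ (Fin (n + 1))) : pExponent p z ≤ 1 := by
  unfold pExponent
  split_ifs
  · norm_num
  · exact (div_le_one (by linarith)).2 hp.le
  · exact (min_le_left _ _).trans (by norm_num)

lemma pExponent_le_of_eq_zero {z : EuclideanSpace ℝ (Fin (n + 1))} {i : Fin n}
    (hi : z i.succ = 0) : pExponent p z ≤ 1 / p := by
  have hcard : (tailSupport z).card ≠ n := by
    intro h
    have h1 : tailSupport z = Finset.univ := Finset.card_eq_iff_eq_univ _ |>.1 (by simpa using h)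
    have h2 : i ∈ tailSupport z := h1 ▸ Finset.mem_univ i
    simp [tailSupport, hi] at h2
  unfold pExponent
  rw [if_neg hcard]
  split_ifs
  · exact le_rfl
  · exact min_le_right _ _

lemma pExponent_le_half_or (z : EuclideanSpace ℝ (Fin (n + 1))) :
    pExponent p z ≤ 1 / 2 ∨ ∃ j : Fin n, ∀ i, i ≠ j → z i.succ = 0 := by
  unfold pExponent
  split_ifs with h1 h2
  · exact Or.inl le_rfl
  · obtain ⟨j, hj⟩ := Finset.card_eq_one.1 h2.1
    refine Or.inr ⟨j, fun i hi => ?_⟩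
    by_contra hne
    have : i ∈ tailSupport z := by simp [tailSupport, hne]
    rw [hj, Finset.mem_singleton] at this
    exact hi this
  · exact Or.inl (min_le_left _ _)

/-- Identifies the coordinates responsible for the exponent, hence the direction of the extremal
perturbation. The hypothesis `2 ≤ n` supplies two nonzero entries when the support is full. -/
lemma pExponent_attained (hn : 2 ≤ n) (hp : 0 < p) {z : EuclideanSpace ℝ (Fin (n + 1))}
    (hz : ∃ i : Fin n, z i.succ ≠ 0) :
    (∃ i : Fin n, z i.succ = 0 ∧ pExponent p z = 1 / p) ∨
      ∃ i j : Fin n, i ≠ j ∧ z i.succ ≠ 0 ∧ z j.succ ≠ 0 ∧ pExponent p z = 1 / 2 := by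
  have hpair : 1 < (tailSupport z).card → ∃ i j : Fin n, i ≠ j ∧ z i.succ ≠ 0 ∧ z j.succ ≠ 0 := by
    intro h
    obtain ⟨i, hi, j, hj, hij⟩ := Finset.one_lt_card.1 h
    exact ⟨i, j, hij, by simpa [tailSupport] using hi, by simpa [tailSupport] using hj⟩
  by_cases h1 : (tailSupport z).card = n
  · obtain ⟨i, j, hij, hi, hj⟩ := hpair (by omega)
    exact Or.inr ⟨i, j, hij, hi, hj, by simp [pExponent, h1]⟩
  · obtain ⟨k, hk⟩ : ∃ k : Fin n, z k.succ = 0 := by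
      by_contra! hall
      exact h1 (by simp [tailSupport, hall])
    by_cases h2 : (tailSupport z).card = 1 ∧ p < 2
    · exact Or.inl ⟨k, hk, by rw [pExponent, if_neg h1, if_pos h2]⟩
    · have hexp : pExponent p z = min (1 / 2) (1 / p) := by rw [pExponent, if_neg h1, if_neg h2]
      rcases lt_or_ge p 2 with hp2 | hp2
      · obtain ⟨m, hm⟩ := hz
        have hpos : 0 < (tailSupport z).card :=
          Finset.card_pos.2 ⟨m, by simp [tailSupport, hm]⟩
        have hne1 : (tailSupport z).card ≠ 1 := fun h => h2 ⟨h, hp2⟩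
        obtain ⟨i, j, hij, hi, hj⟩ := hpair (by omega)
        refine Or.inr ⟨i, j, hij, hi, hj, ?_⟩
        rw [hexp, min_eq_left (one_div_le_one_div_of_le hp hp2.le)]
      · exact Or.inl ⟨k, hk, by
          rw [hexp, min_eq_right (one_div_le_one_div_of_le (by norm_num) hp2)]⟩

end Exponent

/-! ### Optimality: points of the cone that nearly touch the hyperplane. -/

section Optimality

variable {n : ℕ} {p q : ℝ}

/-- The distance estimate at zero pairing. -/
lemma eq_smul_exposedRay_of_inner_eq_zero (h : p.HolderConjugate q)
    {z : EuclideanSpace ℝ (Fin (n + 1))} (hz0 : 0 < z 0) (hz : tailPNorm q z = z 0)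
    {y : EuclideanSpace ℝ (Fin (n + 1))} (hy : y ∈ pCone n p) (hzy : inner ℝ z y = 0) :
    ∃ t : ℝ, 0 ≤ t ∧ y = t • exposedRay q z := by
  obtain ⟨C, -, hC⟩ := exists_norm_sub_exposedRay_le h hz0 hz (pExponent_pos h.pos z)
    (pExponent_le_one h.lt z) (fun i => pExponent_le_of_eq_zero) (pExponent_le_half_or z) ‖y‖
  obtain ⟨t, ht, hyt⟩ := hC y hy le_rfl
  rw [hzy, Real.zero_rpow (pExponent_pos h.pos z).ne', mul_zero] at hyt
  exact ⟨t, ht, by rwa [norm_le_zero_iff, sub_eq_zero] at hyt⟩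

lemma infDist_orthogonal_span_le {E : Type*} [NormedAddCommGroup E] [InnerProductSpace ℝ E]
    {z : E} (hz : z ≠ 0) (x : E) :
    Metric.infDist x ((Submodule.span ℝ {z})ᗮ : Set E) ≤ |inner ℝ z x| / ‖z‖ := by
  have hz' : 0 < ‖z‖ := norm_pos_iff.2 hz
  have hmem : x - (inner ℝ z x / ‖z‖ ^ 2) • z ∈ (Submodule.span ℝ {z})ᗮ := by
    rw [Submodule.mem_orthogonal_singleton_iff_inner_right, inner_sub_right,
      real_inner_smul_right, real_inner_self_eq_norm_sq]
    field_simp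
    ring
  refine (Metric.infDist_le_dist_of_mem hmem).trans_eq ?_
  rw [dist_eq_norm, sub_sub_cancel, norm_smul, Real.norm_eq_abs, abs_div,
    abs_of_nonneg (by positivity : 0 ≤ ‖z‖ ^ 2)]
  field_simp

/-- If moving from the exposed ray along `w` costs only order `γ` in Young's inequality, then the
error bound exponent of the `p`-cone and `{z}ᗮ` is at most `1 / γ`. -/
lemma exists_family_of_youngGap_le (h : p.HolderConjugate q)
    {z : EuclideanSpace ℝ (Fin (n + 1))} (hz0 : 0 < z 0) (hz : tailPNorm q z = z 0)
    {ζ : Fin n → ℝ} (hζ : ζ = fun i => z i.succ / z 0) (w c : Fin n → ℝ)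
    (hw : ∑ i, ζ i * w i = 0) (hc : ∑ i, c i * youngDual q (ζ i) = 0) (hcw : ∑ i, c i * w i ≠ 0)
    {γ G : ℝ} (hγ : 0 < γ) (hG : 0 < G)
    (hgap : ∀ᶠ t in nhdsWithin (0 : ℝ) (Set.Ici 0),
      ∑ i, youngGap p q (ζ i) (youngDual q (ζ i) + t * w i) ≤ G * t ^ γ)
    {η : ℝ} (hη : 0 < η) :
    ∃ κ : ℝ, 0 < κ ∧ ∃ s₀ : ℝ, 0 < s₀ ∧ ∀ s, 0 ≤ s → s ≤ s₀ → ∃ x ∈ pCone n p, ‖x‖ ≤ η ∧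
      Metric.infDist x ((Submodule.span ℝ {z})ᗮ : Set (EuclideanSpace ℝ (Fin (n + 1)))) ≤ κ * s ∧
      s ^ (1 / γ) ≤ κ * Metric.infDist x (pCone n p ∩ (Submodule.span ℝ {z})ᗮ) := by
  have hzne : z ≠ 0 := by rintro rfl; simp at hz0
  have hzn : 0 < ‖z‖ := norm_pos_iff.2 hzne
  have hζ1 : ∑ i, |ζ i| ^ q = 1 := by rw [hζ]; exact sum_div_rpow_eq_one h.symm.pos hz0 hz
  have hζu : ∑ i, ζ i * youngDual q (ζ i) = 1 := by simp only [mul_youngDual h.symm.lt, hζ1]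
  rw [eventually_nhdsWithin_iff] at hgap
  obtain ⟨t₁, ht₁, hball⟩ := Metric.eventually_nhds_iff.1 hgap
  set t₀ := min 1 (t₁ / 2) with ht₀def
  have ht₀ : 0 < t₀ := lt_min one_pos (by positivity)
  -- Bounds `‖y‖` for all steps `t ≤ 1`, so that scaling by `r = η / M` puts the points in the ball
  -- of radius `η`.
  set M := 1 + G + ∑ i, (|youngDual q (ζ i)| + |w i|) with hM
  have hM0 : 0 < M := by positivity
  set r := η / M with hr
  have hr0 : 0 < r := by positivity
  -- Pairing with `φ` vanishes on the exposed ray but not along `w`, so it bounds the distance to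
  -- the ray from below.
  set φ : EuclideanSpace ℝ (Fin (n + 1)) :=
    WithLp.toLp 2 (Fin.cons 0 c : Fin (n + 1) → ℝ) with hφ
  have hφi : ∀ x, inner ℝ φ x = ∑ i, c i * x i.succ := by
    intro x
    rw [inner_eq_coord]
    simp [hφ]
  have hcw' : 0 < |∑ i, c i * w i| := abs_pos.2 hcw
  set κ := r * z 0 * G / ‖z‖ + (‖φ‖ + 1) / (r * |∑ i, c i * w i|) with hκ
  have hκ1 : r * z 0 * G / ‖z‖ ≤ κ := le_add_of_nonneg_right (by positivity)
  have hκ2 : (‖φ‖ + 1) / (r * |∑ i, c i * w i|) ≤ κ := le_add_of_nonneg_left (by positivity)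
  refine ⟨κ, by positivity, t₀ ^ γ, by positivity, fun s hs hs₀ => ?_⟩
  set t := s ^ (1 / γ) with ht
  have ht0 : 0 ≤ t := by positivity
  have htγ : t ^ γ = s := by
    rw [ht, ← Real.rpow_mul hs, one_div_mul_cancel hγ.ne', Real.rpow_one]
  have htle : t ≤ t₀ := by
    by_contra hlt
    exact absurd (Real.rpow_lt_rpow ht₀.le (not_le.1 hlt) hγ) (by rw [htγ]; exact not_lt.2 hs₀)
  have ht1 : t ≤ 1 := htle.trans (min_le_left _ _)
  have hs1 : s ≤ 1 := by rw [← htγ]; exact Real.rpow_le_one ht0 ht1 hγ.le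
  have hgt : ∑ i, youngGap p q (ζ i) (youngDual q (ζ i) + t * w i) ≤ G * s := by
    rw [← htγ]
    refine hball ?_ ht0
    rw [Real.dist_eq, sub_zero, abs_of_nonneg ht0]
    exact lt_of_le_of_lt (htle.trans (min_le_right _ _)) (half_lt_self ht₁)
  set v : Fin n → ℝ := fun i => youngDual q (ζ i) + t * w i with hv
  have hζv : ∑ i, ζ i * v i = 1 := by
    simp only [hv, mul_add, Finset.sum_add_distrib, hζu, mul_left_comm _ t, ← Finset.mul_sum, hw,
      mul_zero, add_zero]
  set S := ∑ i, |v i| ^ p with hS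
  have hS0 : 0 ≤ S := Finset.sum_nonneg fun i _ => by positivity
  set N := S ^ (1 / p) with hN
  have hN0 : 0 ≤ N := by positivity
  -- Young's inequality for the pair `N`, `1` gives `N ≤ N ^ p / p + 1 / q`, so `N - 1` is at most
  -- the sum of the defects.
  have hN1 : N - 1 ≤ G * s := by
    have h1 := sum_youngGap (p := p) hζ1 v
    rw [hζv] at h1
    have h2 := Real.young_inequality_of_nonneg hN0 zero_le_one h
    rw [Real.one_rpow, mul_one, hN, ← Real.rpow_mul hS0, one_div_mul_cancel h.ne_zero,
      Real.rpow_one] at h2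
    linarith
  set y : EuclideanSpace ℝ (Fin (n + 1)) :=
    WithLp.toLp 2 (Fin.cons N fun i => -v i : Fin (n + 1) → ℝ) with hy
  have hyK : y ∈ pCone n p := by
    change tailPNorm p y ≤ N
    simp [tailPNorm, hy, hN, hS]
  have hyM : ‖y‖ ≤ M := by
    refine (norm_le_sum_abs y).trans ?_
    rw [Fin.sum_univ_succ]
    simp only [hy, Fin.cons_zero, Fin.cons_succ, abs_neg, abs_of_nonneg hN0]
    rw [hM]
    refine add_le_add (by nlinarith) (Finset.sum_le_sum fun i _ => ?_)
    refine (abs_add_le _ _).trans ?_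
    rw [abs_mul, abs_of_nonneg ht0]
    gcongr
    exact mul_le_of_le_one_left (abs_nonneg _) ht1
  have hzy : inner ℝ z y = z 0 * (N - 1) := by
    rw [inner_eq_zero_coord_mul z y hz0.ne']
    simp only [hζ] at hζv
    simp [hy, hζv, sub_eq_add_neg]
  have hzy0 : 0 ≤ inner ℝ z y := inner_nonneg_of_mem_pCone h hz.le hyK
  refine ⟨r • y, smul_mem_pCone h.pos hyK hr0.le, ?_, ?_, ?_⟩
  · rw [norm_smul, Real.norm_eq_abs, abs_of_pos hr0, hr]
    calc η / M * ‖y‖ ≤ η / M * M := by gcongr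
      _ = η := by field_simp
  · refine (infDist_orthogonal_span_le hzne _).trans ?_
    rw [real_inner_smul_right, abs_of_nonneg (by positivity), hzy]
    calc r * (z 0 * (N - 1)) / ‖z‖ ≤ r * (z 0 * (G * s)) / ‖z‖ := by gcongr
      _ = r * z 0 * G / ‖z‖ * s := by ring
      _ ≤ κ * s := by gcongr
  · have hlow : r * t * |∑ i, c i * w i| / (‖φ‖ + 1) ≤
        Metric.infDist (r • y) (pCone n p ∩ (Submodule.span ℝ {z})ᗮ) := by
      have hne : (pCone n p ∩ ((Submodule.span ℝ {z})ᗮ : Set _)).Nonempty := by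
        refine ⟨(0 : ℝ) • y, smul_mem_pCone h.pos hyK le_rfl, ?_⟩
        rw [zero_smul]
        exact Submodule.zero_mem _
      refine (Metric.le_infDist hne).2 fun k hk => ?_
      have hzk : inner ℝ z k = 0 := Submodule.mem_orthogonal_singleton_iff_inner_right.1 hk.2
      obtain ⟨τ, -, rfl⟩ := eq_smul_exposedRay_of_inner_eq_zero h hz0 hz hk.1 hzk
      have h1 : inner ℝ φ (τ • exposedRay q z) = 0 := by
        rw [real_inner_smul_right, hφi]
        simp only [exposedRay_succ, mul_neg, Finset.sum_neg_distrib]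
        rw [hζ] at hc
        rw [hc]
        simp
      have h2 : inner ℝ φ (r • y) = -(r * t * ∑ i, c i * w i) := by
        rw [real_inner_smul_right, hφi]
        simp only [hy, Fin.cons_succ, hv, mul_neg, Finset.sum_neg_distrib, mul_add,
          Finset.sum_add_distrib, hc, mul_left_comm _ t, ← Finset.mul_sum, zero_add]
        ring
      have h3 := abs_real_inner_le_norm φ (r • y - τ • exposedRay q z)
      rw [inner_sub_right, h1, h2, sub_zero, abs_neg, abs_mul, abs_of_nonneg (by positivity)] at h3
      rw [div_le_iff₀ (by positivity), dist_eq_norm, mul_comm ‖_‖]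
      refine h3.trans ?_
      gcongr
      linarith
    calc t = (‖φ‖ + 1) / (r * |∑ i, c i * w i|) * (r * t * |∑ i, c i * w i| / (‖φ‖ + 1)) := by
          field_simp
      _ ≤ κ * Metric.infDist (r • y) (pCone n p ∩ (Submodule.span ℝ {z})ᗮ) := by gcongr

-- Along a zero coordinate the defect is exactly `t ^ p / p`. For two nonzero entries, `w` is
-- tangent in their plane and costs `O(t ^ 2)`; its pairing with `c` is `|ζ j| ^ q + |ζ i| ^ q > 0`.
open Filter Topology in
lemma exists_family_pExponent (hn : 2 ≤ n) (h : p.HolderConjugate q)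
    {z : EuclideanSpace ℝ (Fin (n + 1))} (hz0 : 0 < z 0) (hz : tailPNorm q z = z 0)
    {η : ℝ} (hη : 0 < η) :
    ∃ κ : ℝ, 0 < κ ∧ ∃ s₀ : ℝ, 0 < s₀ ∧ ∀ s, 0 ≤ s → s ≤ s₀ → ∃ x ∈ pCone n p, ‖x‖ ≤ η ∧
      Metric.infDist x ((Submodule.span ℝ {z})ᗮ : Set (EuclideanSpace ℝ (Fin (n + 1)))) ≤ κ * s ∧
      s ^ pExponent p z ≤ κ * Metric.infDist x (pCone n p ∩ (Submodule.span ℝ {z})ᗮ) := by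
  have hp := h.pos
  obtain ⟨ζ, hζ⟩ : ∃ ζ : Fin n → ℝ, ζ = fun i => z i.succ / z 0 := ⟨_, rfl⟩
  have hζi : ∀ i, ζ i = 0 ↔ z i.succ = 0 := fun i => by simp [hζ, hz0.ne']
  have hex : ∃ i : Fin n, z i.succ ≠ 0 := by
    by_contra! hall
    have := sum_div_rpow_eq_one h.symm.pos hz0 hz
    simp [hall, Real.zero_rpow h.symm.ne_zero] at this
  rcases pExponent_attained hn hp hex with ⟨i, hi, hexp⟩ | ⟨i, j, hij, hi, hj, hexp⟩
  · rw [hexp]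
    have hi' := (hζi i).2 hi
    refine exists_family_of_youngGap_le h hz0 hz hζ (Pi.single i 1) (Pi.single i 1)
      ?_ ?_ ?_ hp (by positivity : 0 < 1 / p) ?_ hη
    · simp [Pi.single_apply, hi']
    · simp [Pi.single_apply, hi']
    · simp [Pi.single_apply]
    · filter_upwards [self_mem_nhdsWithin] with t ht
      rw [Finset.sum_eq_single i]
      · simp only [hi', youngDual_zero, Pi.single_eq_same, youngGap, abs_zero,
          Real.zero_rpow h.symm.ne_zero, zero_add, mul_one, abs_of_nonneg (Set.mem_Ici.1 ht)]
        apply le_of_eq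
        ring
      · intro k _ hk
        simp [hk, youngGap_youngDual h]
      · simp
  · rw [hexp]
    have hi' : ζ i ≠ 0 := fun h0 => hi ((hζi i).1 h0)
    have hj' : ζ j ≠ 0 := fun h0 => hj ((hζi j).1 h0)
    have hgap : ∀ k, ∃ G : ℝ, 0 < G ∧ ∀ᶠ t in 𝓝[≥] (0 : ℝ),
        youngGap p q (ζ k) (youngDual q (ζ k) +
          t * ((Pi.single i (ζ j) - Pi.single j (ζ i) : Fin n → ℝ) k)) ≤ G * t ^ (2 : ℝ) := by
      intro k
      set w : ℝ := (Pi.single i (ζ j) - Pi.single j (ζ i) : Fin n → ℝ) k with hw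
      by_cases hk : ζ k = 0
      · have hw0 : w = 0 := by
          have h1 : k ≠ i := fun h0 => hi' (h0 ▸ hk)
          have h2 : k ≠ j := fun h0 => hj' (h0 ▸ hk)
          simp [hw, h1, h2]
        refine ⟨1, one_pos, Filter.Eventually.of_forall fun t => ?_⟩
        rw [hw0, mul_zero, add_zero, youngGap_youngDual h, one_mul, Real.rpow_two]
        positivity
      · obtain ⟨_, C, _, hC, hev⟩ := eventually_youngGap_bounds h hk
        refine ⟨C * (w ^ 2 + 1), by positivity, ?_⟩
        have ht : Tendsto (fun t : ℝ => youngDual q (ζ k) + t * w) (𝓝[≥] 0)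
            (𝓝 (youngDual q (ζ k))) := by
          have : Tendsto (fun t : ℝ => youngDual q (ζ k) + t * w) (𝓝 0)
              (𝓝 (youngDual q (ζ k) + 0 * w)) := Continuous.tendsto (by fun_prop) 0
          rw [zero_mul, add_zero] at this
          exact this.mono_left nhdsWithin_le_nhds
        filter_upwards [ht.eventually hev] with t ht
        refine ht.2.trans ?_
        rw [Real.rpow_two, add_sub_cancel_left, mul_pow]
        nlinarith [mul_nonneg hC.le (sq_nonneg t)]
    choose G hG hGev using hgap
    refine exists_family_of_youngGap_le h hz0 hz hζ
      (Pi.single i (ζ j) - Pi.single j (ζ i))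
      (Pi.single i (youngDual q (ζ j)) - Pi.single j (youngDual q (ζ i)))
      ?_ ?_ ?_ two_pos (Finset.sum_pos (fun k _ => hG k) ⟨i, Finset.mem_univ i⟩) ?_ hη
    · simp [Pi.single_apply, mul_sub, Finset.sum_sub_distrib, mul_comm]
    · simp [Pi.single_apply, sub_mul, Finset.sum_sub_distrib]
      ring
    · have hsum : ∑ k, (Pi.single i (youngDual q (ζ j)) - Pi.single j (youngDual q (ζ i)) :
          Fin n → ℝ) k * (Pi.single i (ζ j) - Pi.single j (ζ i) : Fin n → ℝ) k =
          |ζ j| ^ q + |ζ i| ^ q := by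
        rw [← mul_youngDual h.symm.lt, ← mul_youngDual h.symm.lt]
        simp [Pi.single_apply, sub_mul, mul_sub, Finset.sum_sub_distrib, hij, hij.symm]
        ring
      rw [hsum]
      positivity
    · filter_upwards [Filter.eventually_all.2 hGev] with t ht
      rw [Finset.sum_mul]
      exact Finset.sum_le_sum fun k _ => ht k

end Optimality

/-! ### Assembling the error bound and its optimality. -/

section Main

variable {n : ℕ} {p q : ℝ}

lemma holderErrorBound_pExponent (h : p.HolderConjugate q)
    (L : Submodule ℝ (EuclideanSpace ℝ (Fin (n + 1)))) (a : EuclideanSpace ℝ (Fin (n + 1)))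
    (hne : ((AffineSubspace.mk' a L : Set (EuclideanSpace ℝ (Fin (n + 1)))) ∩ pCone n p).Nonempty)
    {z : EuclideanSpace ℝ (Fin (n + 1))} (hz0 : 0 < z 0) (hz : tailPNorm q z = z 0)
    (hzL : z ∈ Lᗮ) (hza : inner ℝ z a = 0) :
    HolderErrorBound (pCone n p) (AffineSubspace.mk' a L) (pExponent p z) := by
  have hα := pExponent_pos h.pos z
  have hα1 := pExponent_le_one h.lt z
  set α := pExponent p z with hαdef
  set f := exposedRay q z with hf
  have hzA : ∀ b ∈ AffineSubspace.mk' a L, inner ℝ z b = 0 := by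
    intro b hb
    have h1 := (Submodule.mem_orthogonal' L z).1 hzL _ (AffineSubspace.mem_mk'.1 hb)
    rwa [vsub_eq_sub, inner_sub_right, hza, sub_zero] at h1
  obtain ⟨x₀, hx₀A, hx₀K⟩ := hne
  obtain ⟨t₀, ht₀, rfl⟩ := eq_smul_exposedRay_of_inner_eq_zero h hz0 hz hx₀K (hzA x₀ hx₀A)
  have hfK : f ∈ pCone n p := by
    have h1 := sum_div_rpow_eq_one h.symm.pos hz0 hz
    simp [pCone, tailPNorm, hf, abs_youngDual_rpow h, h1]
  obtain ⟨C₁, hC₁, hray⟩ := exists_infDist_ray_inter_le f a L ht₀ hx₀A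
    (S := pCone n p ∩ (AffineSubspace.mk' a L : Set _))
    (fun t ht hmem => ⟨smul_mem_pCone h.pos hfK ht, hmem⟩)
  refine ⟨hα, hα1, fun B hB => ?_⟩
  obtain ⟨R, hR, hBR⟩ := hB.subset_closedBall_lt 0 (t₀ • f)
  obtain ⟨C₂, hC₂, hface⟩ := exists_norm_sub_exposedRay_le h hz0 hz hα hα1
    (fun i => pExponent_le_of_eq_zero) (pExponent_le_half_or z) (2 * R + ‖t₀ • f‖)
  -- The linear terms, one from projecting onto each set, are absorbed by `ε ≤ R ^ (1 - α) * ε ^ α`;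
  -- the other term is the distance to the ray.
  refine ⟨C₁ * (2 * R ^ (1 - α) + C₂ * (2 * ‖z‖) ^ α), by positivity, fun x hx => ?_⟩
  set ε := max (Metric.infDist x (pCone n p))
    (Metric.infDist x (AffineSubspace.mk' a L : Set (EuclideanSpace ℝ (Fin (n + 1))))) with hε
  have hxR : dist x (t₀ • f) ≤ R := hBR hx
  obtain ⟨y, hyK, hy⟩ := (isClosed_pCone h.pos).exists_infDist_eq_dist ⟨_, hx₀K⟩ x
  obtain ⟨b, hbA, hb⟩ := (isClosed_mk' a L).exists_infDist_eq_dist ⟨_, hx₀A⟩ x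
  have hyε : ‖x - y‖ ≤ ε := by rw [← dist_eq_norm, ← hy]; exact le_max_left _ _
  have hbε : ‖x - b‖ ≤ ε := by rw [← dist_eq_norm, ← hb]; exact le_max_right _ _
  have hε0 : 0 ≤ ε := (norm_nonneg _).trans hyε
  have hεR : ε ≤ R := max_le ((Metric.infDist_le_dist_of_mem hx₀K).trans hxR)
    ((Metric.infDist_le_dist_of_mem hx₀A).trans hxR)
  have hyR : ‖y‖ ≤ 2 * R + ‖t₀ • f‖ := by
    calc ‖y‖ = ‖(x - t₀ • f) - (x - y) + t₀ • f‖ := by congr 1; abel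
      _ ≤ ‖x - t₀ • f‖ + ‖x - y‖ + ‖t₀ • f‖ :=
        (norm_add_le _ _).trans (by gcongr; exact norm_sub_le _ _)
      _ ≤ _ := by rw [dist_eq_norm] at hxR; linarith
  obtain ⟨t, ht, hyt⟩ := hface y hyK hyR
  have hzy : inner ℝ z y ≤ 2 * ‖z‖ * ε := by
    have h1 : inner ℝ z y = inner ℝ z ((x - b) - (x - y)) := by
      rw [sub_sub_sub_cancel_left, inner_sub_right, hzA b hbA, sub_zero]
    rw [h1]
    calc inner ℝ z ((x - b) - (x - y)) ≤ ‖z‖ * ‖(x - b) - (x - y)‖ := real_inner_le_norm _ _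
      _ ≤ ‖z‖ * (ε + ε) := by
          gcongr
          exact (norm_sub_le _ _).trans (add_le_add hbε hyε)
      _ = _ := by ring
  have hzy0 : 0 ≤ inner ℝ z y := inner_nonneg_of_mem_pCone h hz.le hyK
  have hzα : (inner ℝ z y) ^ α ≤ (2 * ‖z‖) ^ α * ε ^ α := by
    rw [← Real.mul_rpow (by positivity) hε0]
    exact Real.rpow_le_rpow hzy0 hzy hα.le
  have hεα : ε ≤ R ^ (1 - α) * ε ^ α := by
    calc ε = ε ^ (1 - α) * ε ^ α := by
          rw [← Real.rpow_add_of_nonneg hε0 (by linarith) hα.le, sub_add_cancel, Real.rpow_one]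
      _ ≤ _ := by gcongr
  have hxt : ‖x - t • f‖ ≤ ε + C₂ * ((2 * ‖z‖) ^ α * ε ^ α) := by
    calc ‖x - t • f‖ = ‖(x - y) + (y - t • f)‖ := by congr 1; abel
      _ ≤ ‖x - y‖ + ‖y - t • f‖ := norm_add_le _ _
      _ ≤ _ := add_le_add hyε (hyt.trans (by gcongr))
  calc _ ≤ C₁ * (‖x - t • f‖ + ‖x - b‖) := hray x t ht b hbA
    _ ≤ C₁ * ((2 * R ^ (1 - α) + C₂ * (2 * ‖z‖) ^ α) * ε ^ α) := by
        gcongr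
        linarith
    _ = _ := by ring

/-- On the extremal family such a bound would keep a multiple of `s ^ (β - α)` at least `1` as `s →
0`. -/
lemma not_holderErrorBound_of_pExponent_lt (hn : 2 ≤ n) (h : p.HolderConjugate q)
    {z : EuclideanSpace ℝ (Fin (n + 1))} (hz0 : 0 < z 0) (hz : tailPNorm q z = z 0)
    {β : ℝ} (hβ : pExponent p z < β) :
    ¬ HolderErrorBound (pCone n p)
      ((Submodule.span ℝ {z})ᗮ : Set (EuclideanSpace ℝ (Fin (n + 1)))) β := by
  rintro ⟨hβ0, -, hbound⟩
  obtain ⟨κ, hκ, s₀, hs₀, hfam⟩ := exists_family_pExponent hn h hz0 hz one_pos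
  obtain ⟨D, hD, hDB⟩ := hbound _ (Metric.isBounded_closedBall (x := 0) (r := 1))
  set α := pExponent p z
  have hkey : ∀ s : ℝ, 0 < s → s ≤ s₀ → 1 ≤ κ * D * κ ^ β * s ^ (β - α) := by
    intro s hs hss
    obtain ⟨x, hxK, hx1, hxz, hxs⟩ := hfam s hs.le hss
    have h1 := hDB x (by simpa using hx1)
    rw [Metric.infDist_zero_of_mem hxK, max_eq_right Metric.infDist_nonneg] at h1
    have h2 : s ^ α ≤ κ * D * κ ^ β * s ^ (β - α) * s ^ α := by
      calc s ^ α ≤ κ * (D * (κ * s) ^ β) := by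
            refine hxs.trans ?_
            gcongr
            refine h1.trans ?_
            gcongr
            exact Metric.infDist_nonneg
        _ = _ := by
            rw [Real.mul_rpow hκ.le hs.le, mul_assoc _ (s ^ (β - α)), ← Real.rpow_add hs,
              sub_add_cancel]
            ring
    have h3 : 0 < s ^ α := by positivity
    exact le_of_mul_le_mul_right (by rwa [one_mul]) h3
  have hcont : ContinuousAt (fun s : ℝ => κ * D * κ ^ β * s ^ (β - α)) 0 :=
    continuousAt_const.mul (Real.continuousAt_rpow_const _ _ (Or.inr (by linarith)))
  have hev : ∀ᶠ s in nhds (0 : ℝ), κ * D * κ ^ β * s ^ (β - α) < 1 := by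
    refine hcont.eventually (gt_mem_nhds ?_)
    simp [Real.zero_rpow (sub_pos.2 hβ).ne']
  obtain ⟨δ, hδ, hball⟩ := Metric.eventually_nhds_iff.1 hev
  have hs : 0 < min s₀ (δ / 2) := lt_min hs₀ (by positivity)
  refine absurd (hkey _ hs (min_le_left _ _)) (not_le.2 (hball ?_))
  rw [Real.dist_eq, sub_zero, abs_of_pos hs]
  exact lt_of_le_of_lt (min_le_right _ _) (half_lt_self hδ)

/-- The extremal points lie in the cone, so only the distance to the hyperplane enters the first
argument of `Φ`; monotonicity in both arguments does the rest. -/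
lemma rpow_pExponent_le_consistentErrorBound (hn : 2 ≤ n) (h : p.HolderConjugate q)
    {z : EuclideanSpace ℝ (Fin (n + 1))} (hz0 : 0 < z 0) (hz : tailPNorm q z = z 0)
    {Φ : ℝ≥0 → ℝ≥0 → ℝ≥0}
    (hΦ : IsConsistentErrorBound (pCone n p)
      ((Submodule.span ℝ {z})ᗮ : Set (EuclideanSpace ℝ (Fin (n + 1)))) Φ)
    {η : ℝ≥0} (hη : 0 < η) :
    ∃ κ : ℝ≥0, 0 < κ ∧ ∃ s₀ : ℝ≥0, 0 < s₀ ∧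
      ∀ s ≤ s₀, s ^ pExponent p z ≤ κ * Φ (κ * s) η := by
  obtain ⟨κ, hκ, s₀, hs₀, hfam⟩ := exists_family_pExponent hn h hz0 hz (NNReal.coe_pos.2 hη)
  lift κ to ℝ≥0 using hκ.le
  lift s₀ to ℝ≥0 using hs₀.le
  refine ⟨κ, NNReal.coe_pos.1 hκ, s₀, NNReal.coe_pos.1 hs₀, fun s hs => ?_⟩
  obtain ⟨x, hxK, hxη, hxz, hxs⟩ := hfam s s.2 (NNReal.coe_le_coe.2 hs)
  have hmax : max (Metric.infNndist x (pCone n p)) (Metric.infNndist x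
      ((Submodule.span ℝ {z})ᗮ : Set (EuclideanSpace ℝ (Fin (n + 1))))) ≤ κ * s := by
    refine max_le ?_ ?_ <;> rw [← NNReal.coe_le_coe, Metric.coe_infNndist]
    · rw [Metric.infDist_zero_of_mem hxK]
      positivity
    · exact_mod_cast hxz
  have h1 := (hΦ.bound x).trans ((hΦ.mono_left _ hmax).trans (hΦ.mono_right _
    (show ‖x‖₊ ≤ η from hxη)))
  rw [← NNReal.coe_le_coe, Metric.coe_infNndist] at h1
  rw [← NNReal.coe_le_coe]
  push_cast
  exact hxs.trans (by gcongr)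

end Main

theorem theorem4p7 (n : ℕ) (hn : 2 ≤ n) (p q : ℝ) (hp : 1 < p) (hpq : 1 / p + 1 / q = 1) :
    (∀ (L : Submodule ℝ (EuclideanSpace ℝ (Fin (n + 1)))) (a : EuclideanSpace ℝ (Fin (n + 1))),
      ((AffineSubspace.mk' a L : Set (EuclideanSpace ℝ (Fin (n + 1)))) ∩ pCone n p).Nonempty →
      ((((AffineSubspace.mk' a L : Set (EuclideanSpace ℝ (Fin (n + 1)))) ∩ pCone n p = {0}) ∨
          ((AffineSubspace.mk' a L : Set (EuclideanSpace ℝ (Fin (n + 1)))) ∩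
            intrinsicInterior ℝ (pCone n p)).Nonempty) →
        LipschitzErrorBound (pCone n p) (AffineSubspace.mk' a L)) ∧
      (¬(((AffineSubspace.mk' a L : Set (EuclideanSpace ℝ (Fin (n + 1)))) ∩ pCone n p = {0}) ∨
          ((AffineSubspace.mk' a L : Set (EuclideanSpace ℝ (Fin (n + 1)))) ∩
            intrinsicInterior ℝ (pCone n p)).Nonempty) →
        (∃ z ∈ frontier (pCone n q), z ∈ Lᗮ ∧ inner ℝ z a = 0 ∧ z ≠ 0) ∧
        ∀ z ∈ frontier (pCone n q), z ∈ Lᗮ → inner ℝ z a = 0 → z ≠ 0 →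
          min (1 / 2) (1 / p) ≤ pExponent p z ∧
          HolderErrorBound (pCone n p) (AffineSubspace.mk' a L) (pExponent p z))) ∧
    (∀ z ∈ frontier (pCone n q), z ≠ 0 →
      (∀ Φ : ℝ≥0 → ℝ≥0 → ℝ≥0,
        IsConsistentErrorBound (pCone n p)
          ((Submodule.span ℝ {z})ᗮ : Set (EuclideanSpace ℝ (Fin (n + 1)))) Φ →
        ∀ η : ℝ≥0, 0 < η → ∃ κ : ℝ≥0, 0 < κ ∧ ∃ s₀ : ℝ≥0, 0 < s₀ ∧
          ∀ s ≤ s₀, s ^ pExponent p z ≤ κ * Φ (κ * s) η) ∧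
      (∀ β : ℝ, pExponent p z < β → β ≤ 1 →
        ¬ HolderErrorBound (pCone n p)
          ((Submodule.span ℝ {z})ᗮ : Set (EuclideanSpace ℝ (Fin (n + 1)))) β)) := by
  have h : p.HolderConjugate q := Real.holderConjugate_iff.2 ⟨hp, by simpa using hpq⟩
  refine ⟨fun L a hne => ⟨?_, fun hnot => ⟨?_, fun z hz hzL hza hz0 => ⟨min_le_pExponent p z, ?_⟩⟩⟩,
    fun z hz hz0 => ?_⟩
  · rintro (hzero | ⟨x₀, hx₀A, hx₀⟩)
    · have h0 : (0 : EuclideanSpace ℝ (Fin (n + 1))) ∈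
          (AffineSubspace.mk' a L : Set (EuclideanSpace ℝ (Fin (n + 1)))) ∩ pCone n p := by
        rw [hzero]; rfl
      -- Since the origin lies in `L + a`, that set is `L` itself.
      have ha : a ∈ L := by simpa [AffineSubspace.mem_mk'] using h0.1
      have hAL : (AffineSubspace.mk' a L : Set (EuclideanSpace ℝ (Fin (n + 1)))) = L := by
        ext x
        simpa [AffineSubspace.mem_mk'] using L.sub_mem_iff_left ha
      rw [hAL] at hzero ⊢
      exact lipschitzErrorBound_of_inter_eq_zero (isClosed_pCone h.pos)
        (fun x hx t ht => smul_mem_pCone h.pos hx ht) L (by rw [Set.inter_comm, hzero])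
    · exact lipschitzErrorBound_of_mem_interior (convex_pCone hp.le) (isClosed_pCone h.pos)
        (AffineSubspace.mk' a L).convex (isClosed_mk' a L) hx₀A
        (intrinsicInterior_subset_interior (interior_pCone_nonempty h.pos) hx₀)
  · rw [not_or, Set.not_nonempty_iff_eq_empty] at hnot
    refine exists_frontier_supporting h L a hne hnot.1 (Set.disjoint_left.2 fun x hxK hxA => ?_)
    have hx : x ∈ (AffineSubspace.mk' a L : Set (EuclideanSpace ℝ (Fin (n + 1)))) ∩
        intrinsicInterior ℝ (pCone n p) := ⟨hxA, interior_subset_intrinsicInterior hxK⟩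
    rw [hnot.2] at hx
    exact hx
  · have hz' := tailPNorm_eq_of_mem_frontier h.symm.pos hz
    exact holderErrorBound_pExponent h L a hne (pos_of_tailPNorm_eq h.symm.pos hz' hz0) hz' hzL hza
  · have hz' := tailPNorm_eq_of_mem_frontier h.symm.pos hz
    have hzpos := pos_of_tailPNorm_eq h.symm.pos hz' hz0
    exact ⟨fun Φ hΦ η hη => rpow_pExponent_le_consistentErrorBound hn h hzpos hz' hΦ hη,
      fun β hβ _ => not_holderErrorBound_of_pExponent_lt hn h hzpos hz' hβ⟩
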